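/- **Setting.** There are $k+m$ goods. The prices $p\in\mathcal P$ of the first $k$ goods vary, and the prices $r\in\mathbb R_{++}^m$ of the other $m$ goods are fixed ($m=1$ is the usual convention of omitting the last good by Walras' law; $m=0$ lets all prices vary). $\mathcal P\subset\mathbb R_{++}^k$ and $\mathcal Y\subset\mathbb R_{++}$ are open, and $\mathcal Q\subset\mathbb R_{++}^{k+m}$ is a compact convex set of bundles. Preference types $\omega\in\Omega$ have a probability distribution $F$ that does not depend on the budget set. Type $\omega$ has a smooth, strictly quasi-concave utility $u^\omega:\mathcal Q\to\mathbb R$, measurable in $\omega$. For all $(p,y)\in\mathcal P\times\mathcal Y$, some bundle in $\mathcal Q$ is affordable, and preferences are locally nonsatiated at every bundle of $\mathcal Q$ that costs less than $y$. Write $$v^\omega(p,y)=\max\{u^\omega(q): q\in\mathcal Q,\ (p,r)\cdot q\le y\},\qquad e^\omega(p,c)=\min\{(p,r)\cdot q: q\in\mathcal Q,\ u^\omega(q)\ge c\},$$ and let $q^\omega(p,y)\in\mathbb R^k$ be the first $k$ components of the utility-maximizing bundle. Assume that $q^\omega$ is infinitely differentiable on $\mathcal P\times\mathcal Y$, and that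 for every order $j$ there is an $F$-integrable $g_j:\Omega\to\mathbb R$ that bounds the norm of the $j$-th derivative of $q^\omega$ at every $(p,y)\in\mathcal P\times\mathcal Y$. The compensating variation is $$CV^\omega(p_0,p_1,y)=e^\omega(p_1,v^\omega(p_0,y))-e^\omega(p_1,v^\omega(p_1,y)).$$ The $n$-th moment of demand is the tensor $\mathbf M_n(p,y)$ with entries $\mathbb E[q^\omega_{i_1}(p,y)\cdots q^\omega_{i_n}(p,y)]$, $i_1,\dots,i_n\in\{1,\dots,k\}$. For a tensor $A$ of order $l$ and $v\in\mathbb R^k$ put $v(**)A=\sum_{i_1,\dots,i_l}A_{i_1\dots i_l}v_{i_1}\cdots v_{i_l}$. Let $\partial_p\mathbf M_n$ be the tensor of order $n+1$ with entries $\partial(\mathbf M_n)_{i_1\dots i_n}/\partial p_{i_{n+1}}$, let $A^{\top_s}$ denote $A$ with its indices shifted cyclically by $s$ places, and let $$\operatorname{Sym}(\partial_p\mathbf M_n)=\frac1{n+1}\sum_{s=0}^{n}(\partial_p\mathbf M_n)^{\top_s}.$$ **Theorem.** Let $n\ge1$, $p_0\in\mathcal P$ and $y\in\mathcal Y$. All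 moments of demand exist on $\mathcal P\times\mathcal Y$, and $CV^\omega(p_0,p_1,y)^n$ is integrable for all $p_1\in\mathcal P$. The entries of $\mathbf M_n$ are differentiable in $p$, and those of $\mathbf M_{n+1}$ in $y$, at $(p_0,y)$. The second-order approximation of the $n$-th moment of the CV depends only on the $n$-th and $(n+1)$-st moments of demand: as $\Delta p\to0$, $$\mathbb E[CV^\omega(p_0,p_0+\Delta p,y)^n]=\Delta p(**)\mathbf M_n(p_0,y)+\frac12\,\Delta p(**)\Big\{\operatorname{Sym}(\partial_p\mathbf M_n)(p_0,y)+\frac{n}{n+1}\frac{\partial}{\partial y}\mathbf M_{n+1}(p_0,y)\Big\}+O(\|\Delta p\|^{n+2}).$$ Moreover $\Delta p(**)\operatorname{Sym}(\partial_p\mathbf M_n)=\Delta p(**)\frac1n\sum_{s=1}^{n}(\partial_p\mathbf M_n)^{\top_s}$ at $(p_0,y)$, for every $\Delta p\in\mathbb R^k$. -/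

import Mathlib

open MeasureTheory
open scoped Topology Asymptotics

noncomputable section

namespace CVMoments

section Consumer

variable {G : Type*} [Fintype G]

/-- The affordable bundles of the consumption set `Q` at prices `p` and income `y`. -/
def budget (Q : Set (G → ℝ)) (p : G → ℝ) (y : ℝ) : Set (G → ℝ) :=
  {q | q ∈ Q ∧ p ⬝ᵥ q ≤ y}

/-- Uncompensated (Marshallian) demand: a maximiser of the utility `u` on the budget set
(the maximiser, whenever it exists and is unique). -/
def demand (Q : Set (G → ℝ)) (u : (G → ℝ) → ℝ) (p : G → ℝ) (y : ℝ) : G → ℝ :=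
  Classical.epsilon fun q => q ∈ budget Q p y ∧ IsMaxOn u (budget Q p y) q

/-- Indirect utility `v(p, y)`: the greatest utility attainable on the budget set. -/
def indirectUtility (Q : Set (G → ℝ)) (u : (G → ℝ) → ℝ) (p : G → ℝ) (y : ℝ) : ℝ :=
  sSup (u '' budget Q p y)

/-- The expenditure function `e(p, c)`: the least cost of attaining utility level `c`. -/
def expenditure (Q : Set (G → ℝ)) (u : (G → ℝ) → ℝ) (p : G → ℝ) (c : ℝ) : ℝ :=
  sInf ((fun q => p ⬝ᵥ q) '' {q | q ∈ Q ∧ c ≤ u q})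

/-- The compensating variation of a price change from `p₀` to `p₁` at income `y`
(positive for price increases). -/
def compensatingVariation (Q : Set (G → ℝ)) (u : (G → ℝ) → ℝ) (p₀ p₁ : G → ℝ) (y : ℝ) : ℝ :=
  expenditure Q u p₁ (indirectUtility Q u p₀ y) - expenditure Q u p₁ (indirectUtility Q u p₁ y)

/-- Strict quasi-concavity on `Q` (strict convexity of the preferences represented by `u`). -/
def StrictQuasiconcave (Q : Set (G → ℝ)) (u : (G → ℝ) → ℝ) : Prop :=
  ∀ x ∈ Q, ∀ z ∈ Q, x ≠ z → ∀ a b : ℝ, 0 < a → 0 < b → a + b = 1 →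
    min (u x) (u z) < u (a • x + b • z)

end Consumer

/-! There are `k + m` goods. The prices `p` of the first `k` goods may change, and the moments of
demand for these `k` goods are considered; the prices `r` of the remaining `m` goods are held fixed
(with `m = 1`, this is the convention of leaving out the last good). -/

/-- The price vector of all `k + m` goods. -/
def allPrices {k m : ℕ} (r : Fin m → ℝ) (p : Fin k → ℝ) : Fin k ⊕ Fin m → ℝ :=
  Sum.elim p r

/-- Demand for the first `k` goods. -/
def demandK {k m : ℕ} (Q : Set (Fin k ⊕ Fin m → ℝ)) (u : (Fin k ⊕ Fin m → ℝ) → ℝ)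
    (r : Fin m → ℝ) (p : Fin k → ℝ) (y : ℝ) : Fin k → ℝ :=
  fun i => demand Q u (allPrices r p) y (Sum.inl i)

/-- The standing assumptions on a population of consumers with utilities `u ω`, where the preference
type `ω` has distribution `F`, which does not depend on the budget set. -/
structure RegularPopulation {k m : ℕ} {Ω : Type*} [MeasurableSpace Ω] (F : Measure Ω)
    (Q : Set (Fin k ⊕ Fin m → ℝ)) (u : Ω → (Fin k ⊕ Fin m → ℝ) → ℝ)
    (r : Fin m → ℝ) (P : Set (Fin k → ℝ)) (Y : Set ℝ) : Prop where
  /-- The set of bundles is a compact convex set of positive bundles. -/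
  bundles_compact : IsCompact Q
  bundles_convex : Convex ℝ Q
  bundles_pos : ∀ q ∈ Q, ∀ i, 0 < q i
  /-- Prices and incomes are positive and range over open sets. -/
  prices_open : IsOpen P
  prices_pos : ∀ p ∈ P, ∀ i, 0 < p i
  fixed_prices_pos : ∀ i, 0 < r i
  incomes_open : IsOpen Y
  incomes_pos : ∀ y ∈ Y, 0 < y
  /-- Some bundle is affordable at each budget set under consideration. -/
  affordable : ∀ p ∈ P, ∀ y ∈ Y, (budget Q (allPrices r p) y).Nonempty
  utility_measurable : ∀ q ∈ Q, Measurable fun ω => u ω q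
  utility_smooth : ∀ ω, ContDiffOn ℝ (⊤ : ℕ∞) (u ω) Q
  utility_strictQuasiconcave : ∀ ω, StrictQuasiconcave Q (u ω)
  /-- Local nonsatiation, at the bundles that do not exhaust income. (On all of the compact set `Q`
  it would contradict the continuity of utility.) -/
  nonsatiated : ∀ ω, ∀ p ∈ P, ∀ y ∈ Y, ∀ q ∈ Q, allPrices r p ⬝ᵥ q < y →
    ∀ ε > 0, ∃ q' ∈ Q, dist q' q < ε ∧ u ω q < u ω q'
  /-- Individual demand is infinitely differentiable in prices and income. -/
  demand_smooth : ∀ ω,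
    ContDiffOn ℝ (⊤ : ℕ∞) (fun z : (Fin k → ℝ) × ℝ => demandK Q (u ω) r z.1 z.2) (P ×ˢ Y)
  /-- The derivatives of demand of each order are dominated by an integrable function of the type,
  uniformly over the budget sets. -/
  demand_dominated : ∀ j : ℕ, ∃ g : Ω → ℝ, Integrable g F ∧ ∀ ω, ∀ z ∈ P ×ˢ Y,
    ‖iteratedFDeriv ℝ j (fun z : (Fin k → ℝ) × ℝ => demandK Q (u ω) r z.1 z.2) z‖ ≤ g ω

/-- Tensors of order `n` over `ℝ^k`, given by their entries. -/
abbrev Tensor (k n : ℕ) : Type := (Fin n → Fin k) → ℝ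

/-- The tensor form: all `n` slots of `A` are contracted with the vector `v`. -/
def tensorForm {k n : ℕ} (v : Fin k → ℝ) (A : Tensor k n) : ℝ :=
  ∑ i : Fin n → Fin k, A i * ∏ j, v (i j)

/-- The tensor with entries `q_{i₁} q_{i₂} ⋯ q_{iₙ}`. -/
def tensorPower {k : ℕ} (n : ℕ) (q : Fin k → ℝ) : Tensor k n :=
  fun i => ∏ j, q (i j)

/-- The `n`-th moment `M_n(p, y)` of demand (for the first `k` goods), entry by entry. -/
def moment {k m : ℕ} {Ω : Type*} [MeasurableSpace Ω] (F : Measure Ω)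
    (Q : Set (Fin k ⊕ Fin m → ℝ)) (u : Ω → (Fin k ⊕ Fin m → ℝ) → ℝ) (r : Fin m → ℝ)
    (n : ℕ) (p : Fin k → ℝ) (y : ℝ) : Tensor k n :=
  fun i => ∫ ω, tensorPower n (demandK Q (u ω) r p y) i ∂F

/-- The price derivative of a tensor field: the tensor of order `n + 1` with entries
`∂ M_{i₁ … iₙ} / ∂ p_{iₙ₊₁}`. -/
def priceDeriv {k n : ℕ} (M : (Fin k → ℝ) → ℝ → Tensor k n) (p : Fin k → ℝ) (y : ℝ) :
    Tensor k (n + 1) :=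
  fun i => lineDeriv ℝ (fun p' => M p' y (Fin.init i)) p (Pi.single (i (Fin.last n)) 1)

/-- The income derivative of a tensor field, entry by entry. -/
def incomeDeriv {k n : ℕ} (M : (Fin k → ℝ) → ℝ → Tensor k n) (p : Fin k → ℝ) (y : ℝ) :
    Tensor k n :=
  fun i => deriv (fun y' => M p y' i) y

/-- The tensor obtained from `A` by shifting its indices cyclically by `s` places. -/
def cyclicTranspose {k n : ℕ} (s : ℕ) (A : Tensor k n) : Tensor k n :=
  fun i => A fun j => i ((finRotate n ^ s) j)

/-- The symmetrization of a tensor of order `n + 1` that is symmetric in its first `n` indices: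
the mean over the `n + 1` cyclic shifts of its indices (for `n = 1`, this is `(A + Aᵀ) / 2`). -/
def symmetrize {k n : ℕ} (A : Tensor k (n + 1)) : Tensor k (n + 1) :=
  (1 / ((n : ℝ) + 1)) • ∑ s ∈ Finset.range (n + 1), cyclicTranspose s A

/-- The second-order approximation of the `n`-th moment of the compensating variation, as a function
of the field `M` of `n`-th moments and the field `M'` of `(n+1)`-st moments alone. -/
def secondOrderCV {k : ℕ} (n : ℕ) (M : (Fin k → ℝ) → ℝ → Tensor k n)
    (M' : (Fin k → ℝ) → ℝ → Tensor k (n + 1)) (p₀ : Fin k → ℝ) (y : ℝ) (Δ : Fin k → ℝ) : ℝ :=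
  tensorForm Δ (M p₀ y) +
    (1 / 2) * tensorForm Δ
      (symmetrize (priceDeriv M p₀ y) + ((n : ℝ) / ((n : ℝ) + 1)) • incomeDeriv M' p₀ y)

end CVMoments

end

/-! Fix a type, write q for its demand, and put h(t) = e(p₀ + tΔ, v(p₀, y)), so that h(0) = y and,
by duality, CV = h(1) - y. Demand at the compensated income is a supergradient of e in prices, and a
continuous supergradient along the path is a derivative; hence h' = Δ · q(p₀ + tΔ, h), which is
Shephard's lemma. Differentiating once more gives CV = a + b + O(‖Δ‖³) with a = Δ · q and b = ½ Δ ·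
Dq(Δ, a), both at (p₀, y) (`path_expansion`). Therefore CVⁿ = aⁿ + n aⁿ⁻¹ b + O(‖Δ‖ⁿ⁺²)
(`abs_pow_sub_expansion_le`).

By the chain rule, the price part of n aⁿ⁻¹ b is half the derivative of (Δ · q)ⁿ in the price
direction Δ, and its income part is half of n/(n+1) times the income derivative of (Δ · q)ⁿ⁺¹. Once
derivatives are moved outside the expectation, only the n-th and (n+1)-st moments remain
(`secondOrderCV_eq_integral`). Symmetrization is harmless, because contracting every slot with the
same vector ignores the order of the indices.

The delicate point is an integrable remainder. It contains the square of the first derivative of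
demand, and integrability of a bound for that derivative does not make its square integrable. But
demand is bounded, since the bundles form a compact set, so a Landau inequality
(`norm_fderiv_le_sqrt`) bounds the first derivative by a multiple of √G, where G is an integrable
bound for the second derivative. The square is then dominated by a multiple of G. -/

namespace CVMoments

/-! ### Consumer theory: Walras' law, duality, supergradients of expenditure. -/

section Consumer

variable {G : Type*} [Fintype G] {Q : Set (G → ℝ)} {u : (G → ℝ) → ℝ} {p : G → ℝ} {y : ℝ}

theorem continuous_cost (p : G → ℝ) : Continuous fun q : G → ℝ => p ⬝ᵥ q := by
  fun_prop

theorem budget_subset : budget Q p y ⊆ Q := fun _ h => h.1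

theorem isCompact_budget (hQ : IsCompact Q) (p : G → ℝ) (y : ℝ) : IsCompact (budget Q p y) :=
  hQ.inter_right (isClosed_le (continuous_cost p) continuous_const)

theorem demand_spec (hQ : IsCompact Q) (hu : ContinuousOn u Q) (hne : (budget Q p y).Nonempty) :
    demand Q u p y ∈ budget Q p y ∧ IsMaxOn u (budget Q p y) (demand Q u p y) := by
  obtain ⟨q, hq, hmax⟩ := (isCompact_budget hQ p y).exists_isMaxOn hne (hu.mono budget_subset)
  exact Classical.epsilon_spec
    (p := fun q => q ∈ budget Q p y ∧ IsMaxOn u (budget Q p y) q) ⟨q, hq, hmax⟩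

theorem indirectUtility_eq (hQ : IsCompact Q) (hu : ContinuousOn u Q)
    (hne : (budget Q p y).Nonempty) : indirectUtility Q u p y = u (demand Q u p y) := by
  obtain ⟨hq, hmax⟩ := demand_spec hQ hu hne
  refine IsGreatest.csSup_eq ⟨⟨_, hq, rfl⟩, ?_⟩
  rintro _ ⟨x, hx, rfl⟩
  exact hmax hx

/-- Otherwise the midpoint of the two bundles would be affordable and strictly better than demand.
The inequality is the form that the measurability of demand requires. -/
theorem demand_unique (hQ : IsCompact Q) (hu : ContinuousOn u Q) (hconv : Convex ℝ Q)
    (hqc : StrictQuasiconcave Q u) (hne : (budget Q p y).Nonempty) {q : G → ℝ}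
    (hq : q ∈ budget Q p y) (hle : u (demand Q u p y) ≤ u q) : demand Q u p y = q := by
  obtain ⟨hd, hmax⟩ := demand_spec hQ hu hne
  by_contra hneq
  have hlt := hqc _ hd.1 _ hq.1 hneq (1 / 2) (1 / 2) (by norm_num) (by norm_num) (by norm_num)
  rw [min_eq_left hle] at hlt
  refine absurd (hmax (a := (1 / 2 : ℝ) • demand Q u p y + (1 / 2 : ℝ) • q) ⟨?_, ?_⟩)
    (not_le.2 hlt)
  · exact hconv hd.1 hq.1 (by norm_num) (by norm_num) (by norm_num)
  · have h1 := hd.2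
    have h2 := hq.2
    simp only [dotProduct_add, dotProduct_smul, smul_eq_mul]
    linarith

/-- Local nonsatiation at the bundles that do not exhaust income. -/
def Nonsatiated (Q : Set (G → ℝ)) (u : (G → ℝ) → ℝ) (p : G → ℝ) (y : ℝ) : Prop :=
  ∀ q ∈ Q, p ⬝ᵥ q < y → ∀ ε > 0, ∃ q' ∈ Q, dist q' q < ε ∧ u q < u q'

/-- A strict budget inequality is an open condition, so a better bundle close enough to q is still
affordable. -/
theorem Nonsatiated.lt_of_cost_lt (hns : Nonsatiated Q u p y) (hQ : IsCompact Q)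
    (hu : ContinuousOn u Q) {q : G → ℝ} (hq : q ∈ Q) (hlt : p ⬝ᵥ q < y) :
    u q < u (demand Q u p y) := by
  obtain ⟨-, hmax⟩ := demand_spec hQ hu (p := p) (y := y) ⟨q, hq, hlt.le⟩
  obtain ⟨ε, hε, hball⟩ := Metric.isOpen_iff.1
    (isOpen_lt (continuous_cost p) (continuous_const (y := y))) q hlt
  obtain ⟨q', hq', hd, hlt'⟩ := hns q hq hlt ε hε
  exact hlt'.trans_le (hmax ⟨hq', le_of_lt (hball hd)⟩)

/-- Walras' law. -/
theorem Nonsatiated.cost_demand (hns : Nonsatiated Q u p y) (hQ : IsCompact Q)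
    (hu : ContinuousOn u Q) (hne : (budget Q p y).Nonempty) : p ⬝ᵥ demand Q u p y = y := by
  obtain ⟨hd, -⟩ := demand_spec hQ hu hne
  refine le_antisymm hd.2 (not_lt.1 fun hlt => ?_)
  exact lt_irrefl _ (hns.lt_of_cost_lt hQ hu hd.1 hlt)

theorem expenditure_le (hQ : IsCompact Q) {c : ℝ} {q : G → ℝ} (hq : q ∈ Q) (hc : c ≤ u q) :
    expenditure Q u p c ≤ p ⬝ᵥ q := by
  refine csInf_le ?_ ⟨q, ⟨hq, hc⟩, rfl⟩
  exact ((hQ.image (continuous_cost p)).bddBelow).mono (Set.image_mono fun _ h => h.1)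

theorem exists_cost_eq_expenditure (hQ : IsCompact Q) (hu : ContinuousOn u Q) {c : ℝ}
    (hne : ∃ q ∈ Q, c ≤ u q) : ∃ q ∈ Q, c ≤ u q ∧ p ⬝ᵥ q = expenditure Q u p c := by
  have hcl : IsClosed (Q ∩ u ⁻¹' Set.Ici c) :=
    hu.preimage_isClosed_of_isClosed hQ.isClosed isClosed_Ici
  have hcomp : IsCompact (Q ∩ u ⁻¹' Set.Ici c) := hQ.of_isClosed_subset hcl fun _ h => h.1
  obtain ⟨q, hq, hmin⟩ := hcomp.exists_isMinOn hne (continuous_cost p).continuousOn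
  have hleast : IsLeast ((fun q => p ⬝ᵥ q) '' {q | q ∈ Q ∧ c ≤ u q}) (p ⬝ᵥ q) := by
    refine ⟨⟨q, hq, rfl⟩, ?_⟩
    rintro _ ⟨x, hx, rfl⟩
    exact hmin hx
  exact ⟨q, hq.1, hq.2, hleast.csInf_eq.symm⟩

theorem Nonsatiated.expenditure_indirectUtility (hns : Nonsatiated Q u p y) (hQ : IsCompact Q)
    (hu : ContinuousOn u Q) (hne : (budget Q p y).Nonempty) :
    expenditure Q u p (indirectUtility Q u p y) = y := by
  obtain ⟨hd, -⟩ := demand_spec hQ hu hne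
  rw [indirectUtility_eq hQ hu hne]
  refine le_antisymm ((expenditure_le hQ hd.1 le_rfl).trans hd.2) ?_
  obtain ⟨q, hq, hc, hcost⟩ := exists_cost_eq_expenditure (p := p) hQ hu ⟨_, hd.1, le_rfl⟩
  rw [← hcost]
  exact not_lt.1 fun hlt => (hns.lt_of_cost_lt hQ hu hq hlt).not_ge hc

/-- Demand at the compensated income is the cheapest way to attain the utility level: the graph of
the expenditure function lies below its tangent given by demand. -/
theorem Nonsatiated.expenditure_le_add (hQ : IsCompact Q) (hu : ContinuousOn u Q) {c : ℝ}
    (hc : ∃ q ∈ Q, c ≤ u q) (hns : Nonsatiated Q u p (expenditure Q u p c)) (p' : G → ℝ) :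
    expenditure Q u p' c ≤ expenditure Q u p c +
      (p' - p) ⬝ᵥ demand Q u p (expenditure Q u p c) := by
  obtain ⟨q, hq, hcq, hcost⟩ := exists_cost_eq_expenditure (p := p) hQ hu hc
  have hqb : q ∈ budget Q p (expenditure Q u p c) := ⟨hq, hcost.le⟩
  obtain ⟨hd, hmax⟩ := demand_spec hQ hu ⟨q, hqb⟩
  have h1 := hns.cost_demand hQ hu ⟨q, hqb⟩
  have h2 := expenditure_le (p := p') hQ hd.1 (hcq.trans (hmax hqb))
  rw [sub_dotProduct]
  linarith

theorem abs_dotProduct_le (v x : G → ℝ) : |v ⬝ᵥ x| ≤ Fintype.card G * (‖v‖ * ‖x‖) := by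
  refine (Finset.abs_sum_le_sum_abs _ _).trans ?_
  refine (Finset.sum_le_card_nsmul _ _ (‖v‖ * ‖x‖) fun i _ => ?_).trans (by simp)
  rw [abs_mul]
  exact mul_le_mul (norm_le_pi_norm v i) (norm_le_pi_norm x i) (abs_nonneg _) (norm_nonneg _)

/-- Each minimiser is a candidate at the other price vector. Nonsatiation plays no role, so the
bound is available before the compensated income is known to lie in the admissible range. -/
theorem abs_expenditure_sub_le (hQ : IsCompact Q) (hu : ContinuousOn u Q) {c : ℝ}
    (hc : ∃ q ∈ Q, c ≤ u q) {K : ℝ} (p p' : G → ℝ) (hK : ∀ q ∈ Q, |(p' - p) ⬝ᵥ q| ≤ K) :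
    |expenditure Q u p' c - expenditure Q u p c| ≤ K := by
  obtain ⟨q, hq, hcq, hcost⟩ := exists_cost_eq_expenditure (p := p) hQ hu hc
  obtain ⟨q', hq', hcq', hcost'⟩ := exists_cost_eq_expenditure (p := p') hQ hu hc
  have h1 := expenditure_le (p := p') hQ hq hcq
  have h2 := expenditure_le (p := p) hQ hq' hcq'
  have h3 := abs_le.1 (hK q hq)
  have h4 := abs_le.1 (hK q' hq')
  rw [sub_dotProduct] at h3 h4
  rw [abs_le]
  constructor <;> linarith [h3.1, h3.2, h4.1, h4.2]

end Consumer

/-! ### Measurability in the preference type. -/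

section Measurability

variable {G : Type*} [Fintype G] {Ω : Type*} [MeasurableSpace Ω] {Q : Set (G → ℝ)}
  {u : Ω → (G → ℝ) → ℝ}

/-- By continuity the supremum over a compact set is already the supremum over a countable dense
subset. -/
theorem measurable_sSup_image (hu : ∀ ω, ContinuousOn (u ω) Q)
    (hm : ∀ q ∈ Q, Measurable fun ω => u ω q) {K : Set (G → ℝ)} (hKQ : K ⊆ Q)
    (hK : IsCompact K) : Measurable fun ω => sSup (u ω '' K) := by
  rcases K.eq_empty_or_nonempty with rfl | hne
  · simp
  have : Nonempty K := hne.to_subtype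
  have key : (fun ω => sSup (u ω '' K)) =
      fun ω => ⨆ n, u ω (TopologicalSpace.denseSeq K n) := by
    funext ω
    have hcont : Continuous fun x : K => u ω x := ((hu ω).mono hKQ).domRestrict
    have hbdd : BddAbove (u ω '' K) := (hK.image_of_continuousOn ((hu ω).mono hKQ)).bddAbove
    have hbdd' : BddAbove (Set.range fun n => u ω (TopologicalSpace.denseSeq K n)) :=
      hbdd.mono (by rintro _ ⟨n, rfl⟩; exact ⟨_, Subtype.coe_prop _, rfl⟩)
    refine le_antisymm (csSup_le (hne.image _) ?_)
      (ciSup_le fun n => le_csSup hbdd ⟨_, Subtype.coe_prop _, rfl⟩)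
    rintro _ ⟨x, hx, rfl⟩
    have hcl : IsClosed {x : K | u ω x ≤ ⨆ n, u ω (TopologicalSpace.denseSeq K n)} :=
      isClosed_le hcont continuous_const
    have hsub : Set.range (TopologicalSpace.denseSeq K) ⊆
        {x : K | u ω x ≤ ⨆ n, u ω (TopologicalSpace.denseSeq K n)} := by
      rintro _ ⟨n, rfl⟩
      exact le_ciSup hbdd' n
    exact hcl.closure_subset_iff.2 hsub ((TopologicalSpace.denseRange_denseSeq K) ⟨x, hx⟩)
  rw [key]
  exact Measurable.iSup fun n => hm _ (hKQ (Subtype.coe_prop _))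

theorem measurable_indirectUtility (hQ : IsCompact Q) (hu : ∀ ω, ContinuousOn (u ω) Q)
    (hm : ∀ q ∈ Q, Measurable fun ω => u ω q) (p : G → ℝ) (y : ℝ) :
    Measurable fun ω => indirectUtility Q (u ω) p y :=
  measurable_sSup_image hu hm budget_subset (isCompact_budget hQ p y)

/-- By uniqueness, demand lies in a closed set C exactly when the best affordable utility is
attained within C, which compares two measurable suprema. -/
theorem measurable_demand (hQ : IsCompact Q) (hconv : Convex ℝ Q)
    (hu : ∀ ω, ContinuousOn (u ω) Q) (hqc : ∀ ω, StrictQuasiconcave Q (u ω))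
    (hm : ∀ q ∈ Q, Measurable fun ω => u ω q) {p : G → ℝ} {y : ℝ}
    (hne : (budget Q p y).Nonempty) : Measurable fun ω => demand Q (u ω) p y := by
  refine measurable_of_isClosed fun C hC => ?_
  have hcomp : IsCompact (budget Q p y ∩ C) := (isCompact_budget hQ p y).inter_right hC
  have hsub : budget Q p y ∩ C ⊆ Q := fun _ h => h.1.1
  rcases (budget Q p y ∩ C).eq_empty_or_nonempty with h | hne'
  · convert MeasurableSet.empty
    refine Set.eq_empty_of_forall_notMem fun ω hω => ?_
    have : demand Q (u ω) p y ∈ budget Q p y ∩ C := ⟨(demand_spec hQ (hu ω) hne).1, hω⟩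
    simp [h] at this
  · convert measurableSet_le (measurable_indirectUtility hQ hu hm p y)
      (measurable_sSup_image hu hm hsub hcomp)
    ext ω
    simp only [Set.mem_preimage, Set.mem_ofPred_eq, indirectUtility_eq hQ (hu ω) hne]
    obtain ⟨x, hx, hsup⟩ := hcomp.exists_sSup_image_eq hne' ((hu ω).mono hsub)
    constructor
    · intro h
      exact le_csSup (hcomp.image_of_continuousOn ((hu ω).mono hsub)).bddAbove
        ⟨_, ⟨(demand_spec hQ (hu ω) hne).1, h⟩, rfl⟩
    · intro h
      rw [hsup] at h
      rw [demand_unique hQ (hu ω) hconv (hqc ω) hne hx.1 h]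
      exact hx.2

/-- When income t affords some bundle, expenditure is at most t exactly when the target utility is
at most the indirect utility at t. -/
theorem measurable_expenditure (hQ : IsCompact Q) (hu : ∀ ω, ContinuousOn (u ω) Q)
    (hm : ∀ q ∈ Q, Measurable fun ω => u ω q) {c : Ω → ℝ} (hcm : Measurable c)
    (hc : ∀ ω, ∃ q ∈ Q, c ω ≤ u ω q) (p : G → ℝ) :
    Measurable fun ω => expenditure Q (u ω) p (c ω) := by
  refine measurable_of_Iic fun t => ?_
  have hcomp := isCompact_budget hQ p t
  rcases (budget Q p t).eq_empty_or_nonempty with h | hne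
  · convert MeasurableSet.empty
    refine Set.eq_empty_of_forall_notMem fun ω hω => ?_
    obtain ⟨q, hq, -, hcost⟩ := exists_cost_eq_expenditure (p := p) hQ (hu ω) (hc ω)
    have : q ∈ budget Q p t := ⟨hq, hcost.trans_le hω⟩
    simp [h] at this
  · convert measurableSet_le hcm (measurable_indirectUtility hQ hu hm p t)
    ext ω
    simp only [Set.mem_preimage, Set.mem_Iic, Set.mem_ofPred_eq, indirectUtility_eq hQ (hu ω) hne]
    obtain ⟨hd, hmax⟩ := demand_spec hQ (hu ω) hne
    constructor
    · intro h
      obtain ⟨q, hq, hcq, hcost⟩ := exists_cost_eq_expenditure (p := p) hQ (hu ω) (hc ω)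
      exact hcq.trans (hmax ⟨hq, hcost.trans_le h⟩)
    · intro h
      exact (expenditure_le hQ hd.1 h).trans hd.2

end Measurability

/-! ### Landau's inequality and differentiability from supergradients. -/

section Calculus

variable {X V : Type*} [NormedAddCommGroup X] [NormedSpace ℝ X] [NormedAddCommGroup V]
  [NormedSpace ℝ V]

/-- The second derivative bounds the increments of the first one. -/
theorem norm_fderiv_sub_le {f : X → V} {U : Set X} (hU : IsOpen U)
    (hf : ContDiffOn ℝ (⊤ : ℕ∞) f U) {z₀ : X} {R G : ℝ} (hball : Metric.ball z₀ R ⊆ U)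
    (hG : ∀ z ∈ U, ‖iteratedFDeriv ℝ 2 f z‖ ≤ G) :
    ∀ x ∈ Metric.ball z₀ R, ∀ x' ∈ Metric.ball z₀ R,
      ‖fderiv ℝ f x' - fderiv ℝ f x‖ ≤ G * ‖x' - x‖ := by
  intro x hx x' hx'
  have hd : ContDiffOn ℝ (⊤ : ℕ∞) (fderiv ℝ f) U := hf.fderiv_of_isOpen hU (by simp)
  refine (convex_ball z₀ R).norm_image_sub_le_of_norm_fderiv_le (𝕜 := ℝ) (fun z hz => ?_)
    (fun z hz => ?_) hx hx'
  · exact (hd.contDiffAt (hU.mem_nhds (hball hz))).differentiableAt (by simp)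
  · rw [← norm_iteratedFDeriv_one, norm_iteratedFDeriv_fderiv]
    exact hG z (hball hz)

/-- A Landau inequality: the first derivative of a bounded function grows at most like the square
root of the second derivative. -/
theorem norm_fderiv_le_sqrt {f : X → V} {z₀ : X} {ρ C G : ℝ} (hρ : 0 < ρ) (hρ1 : ρ ≤ 1)
    (hG : 1 ≤ G) (hC : 0 ≤ C)
    (hf : ∀ x ∈ Metric.ball z₀ (2 * ρ), DifferentiableAt ℝ f x)
    (hfC : ∀ x ∈ Metric.ball z₀ (2 * ρ), ‖f x‖ ≤ C)
    (hLip : ∀ x ∈ Metric.ball z₀ (2 * ρ), ∀ x' ∈ Metric.ball z₀ (2 * ρ),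
      ‖fderiv ℝ f x' - fderiv ℝ f x‖ ≤ G * ‖x' - x‖) :
    ∀ z ∈ Metric.ball z₀ ρ, ‖fderiv ℝ f z‖ ≤ (4 * C / ρ + 1) * √G := by
  intro z hz
  have hs1 : 1 ≤ √G := Real.one_le_sqrt.2 hG
  have hs0 : 0 < √G := by linarith
  have hsq : √G * √G = G := Real.mul_self_sqrt (by linarith)
  -- A step of length σ bounds the derivative by 2C/σ + Gσ; a σ of order 1/√G makes both terms of
  -- order √G. The bound 1 ≤ G keeps σ below ρ, hence the step inside the doubled ball.
  set σ := ρ / (2 * √G) with hσ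
  have hσ0 : 0 < σ := by positivity
  have hσρ : σ < ρ := by
    rw [hσ, div_lt_iff₀ (by positivity)]
    nlinarith
  have hsub : Metric.closedBall z σ ⊆ Metric.ball z₀ (2 * ρ) := fun x hx => by
    have h1 := Metric.mem_closedBall.1 hx
    have h2 := Metric.mem_ball.1 hz
    have h3 := dist_triangle x z z₀
    exact Metric.mem_ball.2 (by linarith)
  refine ContinuousLinearMap.opNorm_le_of_unit_norm (by positivity) fun v hv => ?_
  have hzm : z ∈ Metric.closedBall z σ := Metric.mem_closedBall_self hσ0.le
  have hw : z + σ • v ∈ Metric.closedBall z σ := by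
    simp [norm_smul, hv, abs_of_pos hσ0]
  have key := (convex_closedBall z σ).norm_image_sub_le_of_norm_hasFDerivWithin_le' (𝕜 := ℝ)
    (f := f) (f' := fderiv ℝ f) (φ := fderiv ℝ f z) (C := G * σ)
    (fun x hx => (hf x (hsub hx)).hasFDerivAt.hasFDerivWithinAt)
    (fun x hx => (hLip z (hsub hzm) x (hsub hx)).trans
      (mul_le_mul_of_nonneg_left (mem_closedBall_iff_norm.1 hx) (by linarith))) hzm hw
  have h1 := hfC _ (hsub hzm)
  have h2 := hfC _ (hsub hw)
  have h3 : ‖fderiv ℝ f z (σ • v)‖ ≤ ‖f (z + σ • v) - f z - fderiv ℝ f z (z + σ • v - z)‖ +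
      (‖f (z + σ • v)‖ + ‖f z‖) := by
    rw [add_sub_cancel_left]
    calc ‖fderiv ℝ f z (σ • v)‖
        = ‖(f (z + σ • v) - f z) - (f (z + σ • v) - f z - fderiv ℝ f z (σ • v))‖ := by
          congr 1; abel
      _ ≤ ‖f (z + σ • v) - f z‖ + ‖f (z + σ • v) - f z - fderiv ℝ f z (σ • v)‖ := norm_sub_le _ _
      _ ≤ _ := by linarith [norm_sub_le (f (z + σ • v)) (f z)]
  rw [add_sub_cancel_left, norm_smul, hv, Real.norm_of_nonneg hσ0.le, mul_one] at key
  rw [add_sub_cancel_left, map_smul, norm_smul, Real.norm_of_nonneg hσ0.le] at h3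
  rw [map_smul] at key
  have h4 : σ * ‖fderiv ℝ f z v‖ ≤ G * σ * σ + 2 * C := by linarith
  have h5 : σ * √G = ρ / 2 := by rw [hσ]; field_simp
  have h6 : σ * ((4 * C / ρ + 1) * √G) = 2 * C + ρ / 2 := by
    calc σ * ((4 * C / ρ + 1) * √G) = (4 * C / ρ + 1) * (σ * √G) := by ring
      _ = _ := by rw [h5]; field_simp; ring
  have h7 : G * σ * σ = ρ / 2 * (ρ / 2) := by rw [← h5, ← hsq]; simp only [Real.sqrt_mul_self hs0.le]; ring
  refine le_of_mul_le_mul_left ?_ hσ0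
  rw [h6]
  nlinarith

/-- A function that lies below its tangents with a continuous slope is differentiable. -/
theorem hasDerivWithinAt_of_le_tangent {h φ : ℝ → ℝ} {s : Set ℝ} {t : ℝ} (ht : t ∈ s)
    (hφ : ContinuousWithinAt φ s t)
    (hle : ∀ t₁ ∈ s, ∀ t₂ ∈ s, h t₁ ≤ h t₂ + (t₁ - t₂) * φ t₂) :
    HasDerivWithinAt h (φ t) s t := by
  rw [hasDerivWithinAt_iff_isLittleO]
  have h1 : (fun x => φ x - φ t) =o[𝓝[s] t] (fun _ => (1 : ℝ)) := by
    rw [Asymptotics.isLittleO_one_iff]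
    exact tendsto_sub_nhds_zero_iff.2 hφ
  have h2 := (Asymptotics.isBigO_refl (fun x : ℝ => x - t) (𝓝[s] t)).mul_isLittleO h1
  simp only [mul_one] at h2
  -- The tangent at t bounds the error above by 0, and the tangent at x bounds it below by (x - t)(φ
  -- x - φ t), which is o(x - t).
  refine Asymptotics.IsBigO.trans_isLittleO (Asymptotics.IsBigO.of_bound 1 ?_) h2
  filter_upwards [self_mem_nhdsWithin] with x hx
  have h3 := hle x hx t ht
  have h4 := hle t ht x hx
  rw [one_mul, Real.norm_eq_abs, Real.norm_eq_abs, smul_eq_mul, abs_of_nonpos (by linarith)]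
  refine le_trans ?_ (neg_le_abs _)
  linarith

end Calculus

/-! ### Taylor expansion along the compensated income path. -/

section Path

variable {k : ℕ} {Z : (Fin k → ℝ) × ℝ → Fin k → ℝ} {p₀ Δ : Fin k → ℝ} {y ρ M S G : ℝ}
  {h : ℝ → ℝ}

/-- The second-order Taylor expansion of a solution of `h' = Δ ⬝ᵥ Z (p₀ + t Δ, h)`, with explicit
remainders. -/
theorem path_expansion (hM : 0 ≤ M) (hΔ : ‖Δ‖ ≤ M) (hMρ : M < ρ) (h0 : h 0 = y) (hS : 0 ≤ S)
    (hG : 0 ≤ G)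
    (hLip : ∀ s ∈ Set.Icc (0 : ℝ) 1, ∀ t ∈ Set.Icc (0 : ℝ) 1, |h s - h t| ≤ M * |s - t|)
    (hle : ∀ s ∈ Set.Icc (0 : ℝ) 1, ∀ t ∈ Set.Icc (0 : ℝ) 1,
      (p₀ + t • Δ, h t) ∈ Metric.ball (p₀, y) ρ →
        h s ≤ h t + (s - t) * (Δ ⬝ᵥ Z (p₀ + t • Δ, h t)))
    (hdot : ∀ x : Fin k → ℝ, |Δ ⬝ᵥ x| ≤ M * ‖x‖)
    (hZM : ∀ z ∈ Metric.ball (p₀, y) ρ, |Δ ⬝ᵥ Z z| ≤ M)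
    (hZ : ∀ z ∈ Metric.ball (p₀, y) ρ, DifferentiableAt ℝ Z z)
    (hZS : ∀ z ∈ Metric.ball (p₀, y) ρ, ‖fderiv ℝ Z z‖ ≤ S)
    (hZG : ∀ z ∈ Metric.ball (p₀, y) ρ,
      ‖fderiv ℝ Z z - fderiv ℝ Z (p₀, y)‖ ≤ G * ‖z - (p₀, y)‖) :
    |h 1 - y - Δ ⬝ᵥ Z (p₀, y)| ≤ M ^ 2 * S ∧
    |h 1 - y - Δ ⬝ᵥ Z (p₀, y)
      - 1 / 2 * (Δ ⬝ᵥ fderiv ℝ Z (p₀, y) (Δ, Δ ⬝ᵥ Z (p₀, y)))| ≤ M ^ 3 * (G + S ^ 2) := by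
  set I := Set.Icc (0 : ℝ) 1 with hI
  have h0I : (0 : ℝ) ∈ I := ⟨le_rfl, zero_le_one⟩
  have h1I : (1 : ℝ) ∈ I := ⟨zero_le_one, le_rfl⟩
  have hconv : Convex ℝ I := convex_Icc 0 1
  set z : ℝ → (Fin k → ℝ) × ℝ := fun t => (p₀ + t • Δ, h t) with hz
  set φ : ℝ → ℝ := fun t => Δ ⬝ᵥ Z (z t) with hφ
  have hz0 : z 0 = (p₀, y) := by simp [hz, h0]
  have hφ0 : φ 0 = Δ ⬝ᵥ Z (p₀, y) := by simp only [hφ, hz0]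
  -- The Lipschitz bound confines the whole path to the ball before anything is known about h', so
  -- no continuation argument is needed.
  have hzM : ∀ t ∈ I, ‖z t - (p₀, y)‖ ≤ M := by
    intro t ht
    have ht1 : |t| ≤ 1 := abs_le.2 ⟨by linarith [ht.1], ht.2⟩
    simp only [hz, Prod.mk_sub_mk, add_sub_cancel_left, Prod.norm_mk, norm_smul, Real.norm_eq_abs]
    refine max_le ?_ ?_
    · nlinarith [norm_nonneg Δ, abs_nonneg t]
    · have := hLip t ht 0 h0I
      rw [h0, sub_zero] at this
      nlinarith
  have hzb : ∀ t ∈ I, z t ∈ Metric.ball (p₀, y) ρ := fun t ht =>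
    mem_ball_iff_norm.2 ((hzM t ht).trans_lt hMρ)
  have hhc : ContinuousOn h I := by
    refine (LipschitzOnWith.of_dist_le_mul (K := ⟨M, hM⟩) fun s hs t ht => ?_).continuousOn
    exact hLip s hs t ht
  have hzc : ContinuousOn z I :=
    ContinuousOn.prodMk (by fun_prop) hhc
  have hdotc : ∀ v : Fin k → ℝ, Continuous fun x : Fin k → ℝ => v ⬝ᵥ x := continuous_cost
  have hφc : ContinuousOn φ I := fun t ht =>
    (hdotc Δ).continuousAt.comp_continuousWithinAt
      ((hZ _ (hzb t ht)).continuousAt.comp_continuousWithinAt (hzc t ht))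
  have hh' : ∀ t ∈ I, HasDerivWithinAt h (φ t) I t := fun t ht =>
    hasDerivWithinAt_of_le_tangent ht (hφc t ht) fun s hs t ht => hle s hs t ht (hzb t ht)
  have hz' : ∀ t ∈ I, HasDerivWithinAt z (Δ, φ t) I t := by
    intro t ht
    have h1 : HasDerivAt (fun t : ℝ => p₀ + t • Δ) Δ t := by
      simpa using ((hasDerivAt_id t).smul_const Δ).const_add p₀
    exact h1.hasDerivWithinAt.prodMk (hh' t ht)
  set ψ : ℝ → ℝ := fun t => Δ ⬝ᵥ fderiv ℝ Z (z t) (Δ, φ t) with hψ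
  have hφ' : ∀ t ∈ I, HasDerivWithinAt φ (ψ t) I t := by
    intro t ht
    have h1 := (hZ _ (hzb t ht)).hasFDerivAt.comp_hasDerivWithinAt t (hz' t ht)
    have h2 := hasDerivWithinAt_pi.1 h1
    exact HasDerivWithinAt.fun_sum fun i _ => (h2 i).const_mul (Δ i)
  have hzn : ∀ t ∈ I, ‖((Δ, φ t) : (Fin k → ℝ) × ℝ)‖ ≤ M := fun t ht => by
    rw [Prod.norm_mk]
    exact max_le hΔ (hZM _ (hzb t ht))
  have hψM : ∀ t ∈ I, ‖ψ t‖ ≤ M ^ 2 * S := by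
    intro t ht
    calc ‖ψ t‖ ≤ M * ‖fderiv ℝ Z (z t) (Δ, φ t)‖ := hdot _
      _ ≤ M * (S * M) := by
        gcongr
        exact (ContinuousLinearMap.le_opNorm _ _).trans
          (mul_le_mul (hZS _ (hzb t ht)) (hzn t ht) (norm_nonneg _) hS)
      _ = M ^ 2 * S := by ring
  have hφL : ∀ t ∈ I, ‖φ t - φ 0‖ ≤ M ^ 2 * S := by
    intro t ht
    refine (hconv.norm_image_sub_le_of_norm_hasDerivWithin_le hφ' hψM h0I ht).trans ?_
    rw [sub_zero, Real.norm_of_nonneg ht.1]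
    exact mul_le_of_le_one_right (by positivity) ht.2
  have hψL : ∀ t ∈ I, ‖ψ t - ψ 0‖ ≤ M ^ 3 * (G + S ^ 2) := by
    intro t ht
    -- Here ψ is the second derivative of h. Its change splits into the change of the derivative of
    -- Z, controlled by G, and the change of the direction of differentiation, whose bound
    -- contributes S ^ 2.
    have e : ψ t - ψ 0 = Δ ⬝ᵥ ((fderiv ℝ Z (z t) - fderiv ℝ Z (p₀, y)) (Δ, φ t) +
        fderiv ℝ Z (p₀, y) (0, φ t - φ 0)) := by
      have : ((0, φ t - φ 0) : (Fin k → ℝ) × ℝ) = (Δ, φ t) - (Δ, φ 0) := by simp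
      simp only [hψ, this, map_sub, hz0, sub_apply, ← dotProduct_sub]
      congr 1
      abel
    rw [e]
    refine (hdot _).trans ?_
    have h1 : ‖(fderiv ℝ Z (z t) - fderiv ℝ Z (p₀, y)) (Δ, φ t)‖ ≤ G * M * M := by
      refine (ContinuousLinearMap.le_opNorm _ _).trans ?_
      refine mul_le_mul ((hZG _ (hzb t ht)).trans ?_) (hzn t ht) (norm_nonneg _) (by positivity)
      exact mul_le_mul_of_nonneg_left (hzM t ht) hG
    have h2 : ‖fderiv ℝ Z (p₀, y) (0, φ t - φ 0)‖ ≤ S * (M ^ 2 * S) := by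
      refine (ContinuousLinearMap.le_opNorm _ _).trans ?_
      refine mul_le_mul (hz0 ▸ hZS _ (hzb 0 h0I)) ?_ (norm_nonneg _) hS
      rw [Prod.norm_mk, norm_zero]
      exact max_le (by positivity) (hφL t ht)
    calc M * ‖_ + _‖ ≤ M * (G * M * M + S * (M ^ 2 * S)) := by
          gcongr
          exact (norm_add_le _ _).trans (add_le_add h1 h2)
      _ = _ := by ring
  have hf : ∀ t ∈ I, ‖φ t - φ 0 - t * ψ 0‖ ≤ M ^ 3 * (G + S ^ 2) := by
    intro t ht
    have hd : ∀ t ∈ I, HasDerivWithinAt (fun t => φ t - φ 0 - t * ψ 0) (ψ t - ψ 0) I t :=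
      fun t ht => by
        simpa using ((hφ' t ht).sub_const (φ 0)).fun_sub
          (((hasDerivAt_id t).mul_const (ψ 0)).hasDerivWithinAt (s := I))
    have := hconv.norm_image_sub_le_of_norm_hasDerivWithin_le hd hψL h0I ht
    simp only [sub_self, zero_mul, sub_zero] at this
    refine this.trans ?_
    rw [Real.norm_of_nonneg ht.1]
    exact mul_le_of_le_one_right (by positivity) ht.2
  constructor
  · have hd : ∀ t ∈ I, HasDerivWithinAt (fun t => h t - t * φ 0) (φ t - φ 0) I t :=
      fun t ht => by
        simpa using (hh' t ht).fun_sub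
          (((hasDerivAt_id t).mul_const (φ 0)).hasDerivWithinAt (s := I))
    have := hconv.norm_image_sub_le_of_norm_hasDerivWithin_le hd hφL h0I h1I
    simp only [h0, hφ0, Real.norm_eq_abs] at this
    exact (congrArg abs (by ring)).trans_le (this.trans_eq (by norm_num))
  · have hd : ∀ t ∈ I, HasDerivWithinAt (fun t => h t - t * φ 0 - 1 / 2 * t ^ 2 * ψ 0)
        (φ t - φ 0 - t * ψ 0) I t := fun t ht => by
      have h2 : HasDerivAt (fun t : ℝ => 1 / 2 * t ^ 2 * ψ 0) (t * ψ 0) t := by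
        have := ((hasDerivAt_pow 2 t).const_mul (1 / 2)).mul_const (ψ 0)
        exact this.congr_deriv (by push_cast; ring)
      simpa using ((hh' t ht).fun_sub
          (((hasDerivAt_id t).mul_const (φ 0)).hasDerivWithinAt (s := I))).fun_sub
          (h2.hasDerivWithinAt (s := I))
    have := hconv.norm_image_sub_le_of_norm_hasDerivWithin_le hd hf h0I h1I
    have hψ0 : ψ 0 = Δ ⬝ᵥ fderiv ℝ Z (p₀, y) (Δ, Δ ⬝ᵥ Z (p₀, y)) := by
      simp only [hψ, hz0, hφ0]
    simp only [h0, hφ0, hψ0, Real.norm_eq_abs] at this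
    exact (congrArg abs (by ring)).trans_le (this.trans_eq (by norm_num))

end Path

/-! ### From the expansion of a number to that of its powers. -/

section Powers

/-- The remainder of the first-order expansion of `x ^ n` around `a`. -/
theorem abs_pow_sub_sub_le {x a M G : ℝ} (hx : |x| ≤ M) (ha : |a| ≤ M)
    (h : (x - a) ^ 2 ≤ M ^ 4 * G) (n : ℕ) :
    |x ^ (n + 1) - a ^ (n + 1) - (n + 1) * a ^ n * (x - a)| ≤ (n + 1) ^ 2 * (M ^ (n + 3) * G) := by
  have hM : 0 ≤ M := (abs_nonneg x).trans hx
  have hMG : 0 ≤ M ^ 4 * G := (sq_nonneg _).trans h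
  induction n with
  | zero =>
    -- The remainder vanishes here, so only the sign of the bound matters; the sign of G is
    -- recovered from `hMG` unless M = 0.
    have hM3 : 0 ≤ M ^ 3 * G := by
      rcases hM.eq_or_lt with h0 | h0
      · simp [← h0]
      · have : 0 ≤ G := nonneg_of_mul_nonneg_right hMG (by positivity)
        positivity
    simpa using hM3
  | succ j ih =>
    have e : x ^ (j + 1 + 1) - a ^ (j + 1 + 1) - ((j + 1 : ℕ) + 1 : ℝ) * a ^ (j + 1) * (x - a) =
        x * (x ^ (j + 1) - a ^ (j + 1) - (j + 1) * a ^ j * (x - a)) +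
          (j + 1) * a ^ j * (x - a) ^ 2 := by
      push_cast; ring
    rw [e]
    have h1 : |x * (x ^ (j + 1) - a ^ (j + 1) - (j + 1) * a ^ j * (x - a))| ≤
        M * ((j + 1) ^ 2 * (M ^ (j + 3) * G)) := by
      rw [abs_mul]
      exact mul_le_mul hx ih (abs_nonneg _) hM
    have h2 : |(j + 1) * a ^ j * (x - a) ^ 2| ≤ (j + 1) * M ^ j * (M ^ 4 * G) := by
      rw [abs_mul, abs_mul, abs_pow, abs_of_nonneg (by positivity : (0 : ℝ) ≤ j + 1),
        abs_of_nonneg (sq_nonneg (x - a))]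
      gcongr
    have h3 : 0 ≤ M ^ (j + 4) * G := by
      rw [pow_add, mul_assoc]; positivity
    refine (abs_add_le _ _).trans ((add_le_add h1 h2).trans ?_)
    have e1 : M * ((j + 1) ^ 2 * (M ^ (j + 3) * G)) + (j + 1) * M ^ j * (M ^ 4 * G) =
        ((j + 1) ^ 2 + (j + 1)) * (M ^ (j + 4) * G) := by ring
    rw [e1, show j + 1 + 3 = j + 4 by ring]
    refine mul_le_mul_of_nonneg_right ?_ h3
    push_cast
    nlinarith [(Nat.cast_nonneg j : (0 : ℝ) ≤ j)]

/-- The second-order expansion of a power. -/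
theorem abs_pow_sub_expansion_le {x a b M G B : ℝ} (hx : |x| ≤ M) (ha : |a| ≤ M)
    (h : (x - a) ^ 2 ≤ M ^ 4 * (B * G)) (hb : |x - a - b| ≤ M ^ 3 * (B * G)) (n : ℕ) :
    |x ^ (n + 1) - (a ^ (n + 1) + (n + 1) * a ^ n * b)| ≤
      ((n + 1) ^ 2 + (n + 1)) * (M ^ (n + 3) * (B * G)) := by
  have hM : 0 ≤ M := (abs_nonneg x).trans hx
  have e : x ^ (n + 1) - (a ^ (n + 1) + (n + 1) * a ^ n * b) =
      (x ^ (n + 1) - a ^ (n + 1) - (n + 1) * a ^ n * (x - a)) + (n + 1) * a ^ n * (x - a - b) := by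
    ring
  rw [e]
  refine (abs_add_le _ _).trans ?_
  have h2 : |(n + 1) * a ^ n * (x - a - b)| ≤ (n + 1) * M ^ n * (M ^ 3 * (B * G)) := by
    rw [abs_mul, abs_mul, abs_pow, abs_of_nonneg (by positivity : (0 : ℝ) ≤ n + 1)]
    gcongr
  refine (add_le_add (abs_pow_sub_sub_le hx ha h n) h2).trans (le_of_eq ?_)
  ring

end Powers

/-! ### Differentiation under the integral sign. -/

section Integrals

variable {Ω : Type*} [MeasurableSpace Ω] {X : Type*} [NormedAddCommGroup X] [NormedSpace ℝ X]

/-- The derivative is a limit of difference quotients. Measurability is assumed only in the ball, so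
K makes every step v / c n shorter than ρ. -/
theorem measurable_fderiv_apply_of_forall_mem_ball {f : Ω → X → ℝ} {z₀ : X} {ρ : ℝ} (hρ : 0 < ρ)
    (hm : ∀ z ∈ Metric.ball z₀ ρ, Measurable fun ω => f ω z)
    (hd : ∀ ω, DifferentiableAt ℝ (f ω) z₀) (v : X) :
    Measurable fun ω => fderiv ℝ (f ω) z₀ v := by
  set K : ℝ := ‖v‖ / ρ + 1
  have hK : 0 < K := by positivity
  have hvK : ‖v‖ < ρ * K := by
    have : ρ * K = ‖v‖ + ρ := by simp only [K]; field_simp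
    linarith
  set c : ℕ → ℝ := fun n => K * (n + 1)
  have hc0 : ∀ n, 0 < c n := fun n => by positivity
  have hc : Filter.Tendsto (fun n => ‖c n‖) Filter.atTop Filter.atTop := by
    simp only [Real.norm_of_nonneg (hc0 _).le]
    exact (tendsto_natCast_atTop_atTop.atTop_add tendsto_const_nhds).const_mul_atTop hK
  have hmc : ∀ n, Measurable fun ω => c n • (f ω (z₀ + (c n)⁻¹ • v) - f ω z₀) := fun n => by
    refine Measurable.const_mul (Measurable.sub (hm _ ?_) (hm _ (Metric.mem_ball_self hρ))) _
    rw [mem_ball_iff_norm, add_sub_cancel_left, norm_smul, norm_inv, Real.norm_of_nonneg (hc0 n).le,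
      inv_mul_lt_iff₀ (hc0 n)]
    refine hvK.trans_le ?_
    have : K ≤ c n := le_mul_of_one_le_right hK.le (by linarith [(Nat.cast_nonneg n : (0 : ℝ) ≤ n)])
    nlinarith
  exact measurable_of_tendsto_metrizable hmc
    (tendsto_pi_nhds.2 fun ω => (hd ω).hasFDerivAt.lim v hc)

theorem stronglyMeasurable_of_apply [FiniteDimensional ℝ X] {L : Ω → X →L[ℝ] ℝ}
    (hL : ∀ v, Measurable fun ω => L ω v) : StronglyMeasurable L := by
  let b := Module.finBasis ℝ X
  have key : L = fun ω => ∑ i, L ω (b i) • LinearMap.toContinuousLinearMap (b.coord i) := by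
    funext ω
    ext x
    conv_lhs => rw [← b.sum_repr x, map_sum]
    simp [mul_comm]
  rw [key]
  exact Finset.stronglyMeasurable_fun_sum _ fun i _ => (hL _).stronglyMeasurable.smul_const _

variable {V : Type*} [NormedAddCommGroup V] [NormedSpace ℝ V] [FiniteDimensional ℝ V]
  [MeasurableSpace V] [BorelSpace V] [FiniteDimensional ℝ X]

/-- Differentiation under the integral sign, for a function of a uniformly bounded random field
whose derivative is dominated by an integrable function. -/
theorem hasFDerivAt_integral_comp {F : Measure Ω} [IsFiniteMeasure F] {Z : Ω → X → V} {z₀ : X}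
    {ρ C : ℝ} {g : Ω → ℝ} (hρ : 0 < ρ)
    (hZm : ∀ z ∈ Metric.ball z₀ ρ, Measurable fun ω => Z ω z)
    (hZC : ∀ ω, ∀ z ∈ Metric.ball z₀ ρ, ‖Z ω z‖ ≤ C)
    (hZd : ∀ ω, ∀ z ∈ Metric.ball z₀ ρ, DifferentiableAt ℝ (Z ω) z)
    (hg : Integrable g F) (hZg : ∀ ω, ∀ z ∈ Metric.ball z₀ ρ, ‖fderiv ℝ (Z ω) z‖ ≤ g ω)
    {Φ : V → ℝ} (hΦ : ContDiff ℝ 1 Φ) :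
    Integrable (fun ω => Φ (Z ω z₀)) F ∧
    Integrable (fun ω => fderiv ℝ (fun z => Φ (Z ω z)) z₀) F ∧
    HasFDerivAt (fun z => ∫ ω, Φ (Z ω z) ∂F) (∫ ω, fderiv ℝ (fun z => Φ (Z ω z)) z₀ ∂F) z₀ := by
  have hz₀ := Metric.mem_ball_self (x := z₀) hρ
  have : ProperSpace V := FiniteDimensional.proper ℝ V
  -- The field takes values in a compact ball, so Φ and its derivative are bounded there and no
  -- growth condition on Φ is needed.
  obtain ⟨B₀, hB₀⟩ := (isCompact_closedBall (0 : V) C).exists_bound_of_continuousOn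
    hΦ.continuous.continuousOn
  obtain ⟨B, hB⟩ := (isCompact_closedBall (0 : V) C).exists_bound_of_continuousOn
    (hΦ.continuous_fderiv one_ne_zero).continuousOn
  have hd : ∀ ω, ∀ z ∈ Metric.ball z₀ ρ, HasFDerivAt (fun z => Φ (Z ω z))
      ((fderiv ℝ Φ (Z ω z)).comp (fderiv ℝ (Z ω) z)) z := fun ω z hz =>
    (hΦ.differentiable one_ne_zero _).hasFDerivAt.comp z (hZd ω z hz).hasFDerivAt
  have hm : ∀ z ∈ Metric.ball z₀ ρ, Measurable fun ω => Φ (Z ω z) := fun z hz =>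
    hΦ.continuous.measurable.comp (hZm z hz)
  have hmem : ∀ ω, ∀ z ∈ Metric.ball z₀ ρ, Z ω z ∈ Metric.closedBall (0 : V) C := fun ω z hz =>
    mem_closedBall_zero_iff.2 (hZC ω z hz)
  have hbound : ∀ ω, ∀ z ∈ Metric.ball z₀ ρ, ‖fderiv ℝ (fun z => Φ (Z ω z)) z‖ ≤ B * g ω := by
    intro ω z hz
    rw [(hd ω z hz).fderiv]
    have hB' := hB _ (hmem ω z hz)
    exact (ContinuousLinearMap.opNorm_comp_le _ _).trans
      (mul_le_mul hB' (hZg ω z hz) (norm_nonneg _) ((norm_nonneg _).trans hB'))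
  have hint : Integrable (fun ω => Φ (Z ω z₀)) F :=
    Integrable.of_bound (hm z₀ hz₀).aestronglyMeasurable B₀
      (Filter.Eventually.of_forall fun ω => hB₀ _ (hmem ω z₀ hz₀))
  have hmf : StronglyMeasurable fun ω => fderiv ℝ (fun z => Φ (Z ω z)) z₀ :=
    stronglyMeasurable_of_apply fun v => measurable_fderiv_apply_of_forall_mem_ball hρ hm
      (fun ω => (hd ω z₀ hz₀).differentiableAt) v
  refine ⟨hint, (hg.const_mul B).mono' hmf.aestronglyMeasurable
    (Filter.Eventually.of_forall fun ω => hbound ω z₀ hz₀), ?_⟩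
  refine hasFDerivAt_integral_of_dominated_of_fderiv_le
    (F' := fun z ω => fderiv ℝ (fun z => Φ (Z ω z)) z) (Metric.ball_mem_nhds z₀ hρ) ?_ hint
    hmf.aestronglyMeasurable (Filter.Eventually.of_forall fun ω => hbound ω) (hg.const_mul B)
    (Filter.Eventually.of_forall fun ω z hz => (hd ω z hz).differentiableAt.hasFDerivAt)
  filter_upwards [Metric.ball_mem_nhds z₀ hρ] with z hz
  exact (hm z hz).aestronglyMeasurable

end Integrals

/-! ### Contractions of tensors and of their derivatives. -/

section Tensors

variable {k n : ℕ}

theorem tensorForm_add (v : Fin k → ℝ) (A B : Tensor k n) :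
    tensorForm v (A + B) = tensorForm v A + tensorForm v B := by
  simp [tensorForm, add_mul, Finset.sum_add_distrib]

theorem tensorForm_smul (v : Fin k → ℝ) (c : ℝ) (A : Tensor k n) :
    tensorForm v (c • A) = c * tensorForm v A := by
  simp [tensorForm, Finset.mul_sum, mul_assoc]

theorem tensorForm_sum {ι : Type*} (v : Fin k → ℝ) (s : Finset ι) (A : ι → Tensor k n) :
    tensorForm v (∑ j ∈ s, A j) = ∑ j ∈ s, tensorForm v (A j) := by
  simp only [tensorForm, Finset.sum_apply, Finset.sum_mul]
  exact Finset.sum_comm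

theorem tensorForm_tensorPower (v q : Fin k → ℝ) :
    tensorForm v (tensorPower n q) = (v ⬝ᵥ q) ^ n := by
  simp only [tensorForm, tensorPower, ← Finset.prod_mul_distrib, dotProduct]
  rw [← Fin.prod_const, Finset.prod_univ_sum, Fintype.piFinset_univ]
  simp only [mul_comm]

theorem tensorForm_cyclicTranspose (v : Fin k → ℝ) (s : ℕ) (A : Tensor k n) :
    tensorForm v (cyclicTranspose s A) = tensorForm v A := by
  set e := finRotate n ^ s with he
  refine Fintype.sum_equiv (Equiv.arrowCongr e.symm (Equiv.refl (Fin k))) _ _ fun i => ?_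
  congr 1
  exact (Equiv.prod_comp e fun j => v (i j)).symm

theorem tensorForm_symmetrize (v : Fin k → ℝ) (A : Tensor k (n + 1)) :
    tensorForm v (symmetrize A) = tensorForm v A := by
  simp only [symmetrize, tensorForm_smul, tensorForm_sum, tensorForm_cyclicTranspose,
    Finset.sum_const, Finset.card_range, nsmul_eq_mul]
  push_cast
  field_simp

theorem tensorForm_mean_cyclicTranspose (hn : 1 ≤ n) (v : Fin k → ℝ) (A : Tensor k (n + 1)) :
    tensorForm v ((1 / (n : ℝ)) • ∑ s ∈ Finset.Icc 1 n, cyclicTranspose s A) =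
      tensorForm v A := by
  have : (n : ℝ) ≠ 0 := by positivity
  simp only [tensorForm_smul, tensorForm_sum, tensorForm_cyclicTranspose,
    Finset.sum_const, Nat.card_Icc, nsmul_eq_mul, Nat.add_sub_cancel]
  field_simp

/-- Contracting the last slot with v turns partial derivatives into the derivative along v; the
other slots carry constant coefficients. -/
theorem tensorForm_priceDeriv {M : (Fin k → ℝ) → ℝ → Tensor k n} {p : Fin k → ℝ} {y : ℝ}
    (hM : ∀ i, DifferentiableAt ℝ (fun p => M p y i) p) (v : Fin k → ℝ) :
    tensorForm v (priceDeriv M p y) = fderiv ℝ (fun p => tensorForm v (M p y)) p v := by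
  have h1 : HasFDerivAt (fun p => tensorForm v (M p y))
      (∑ i, (∏ j, v (i j)) • fderiv ℝ (fun p => M p y i) p) p :=
    HasFDerivAt.fun_sum fun i _ => (hM i).hasFDerivAt.mul_const _
  rw [h1.fderiv]
  have hv : v = ∑ l, v l • Pi.single l 1 := by
    ext j
    simp [Finset.sum_apply, Pi.single_apply]
  rw [tensorForm, ← Equiv.sum_comp (Fin.snocEquiv fun _ => Fin k), Fintype.sum_prod_type,
    Finset.sum_comm, sum_apply]
  refine Finset.sum_congr rfl fun i _ => ?_
  conv_rhs => rw [smul_apply, hv, map_sum, Finset.smul_sum]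
  refine Finset.sum_congr rfl fun l _ => ?_
  simp only [priceDeriv, Fin.snocEquiv, Equiv.coe_fn_mk, Fin.init_snoc, Fin.snoc_last,
    (hM i).lineDeriv_eq_fderiv, Fin.prod_univ_castSucc, Fin.snoc_castSucc, map_smul, smul_eq_mul,
    ← hv]
  ring

theorem tensorForm_incomeDeriv {M : (Fin k → ℝ) → ℝ → Tensor k n} {p : Fin k → ℝ} {y : ℝ}
    (hM : ∀ i, DifferentiableAt ℝ (fun y => M p y i) y) (v : Fin k → ℝ) :
    tensorForm v (incomeDeriv M p y) = deriv (fun y => tensorForm v (M p y)) y :=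
  (HasDerivAt.fun_sum fun i _ => (hM i).hasDerivAt.mul_const _).deriv.symm

theorem contDiff_tensorPower (i : Fin n → Fin k) :
    ContDiff ℝ 1 fun q : Fin k → ℝ => tensorPower n q i :=
  contDiff_prod fun j _ => contDiff_apply ℝ ℝ (i j)

end Tensors

/-! ### Uniform expansions over types and their expectations. -/

section Population

variable {k m : ℕ} {Ω : Type*} [MeasurableSpace Ω] {F : Measure Ω}
  {Q : Set (Fin k ⊕ Fin m → ℝ)} {u : Ω → (Fin k ⊕ Fin m → ℝ) → ℝ}
  {r : Fin m → ℝ} {P : Set (Fin k → ℝ)} {Y : Set ℝ}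

theorem allPrices_sub_dotProduct (r : Fin m → ℝ) (p p' : Fin k → ℝ) (q : Fin k ⊕ Fin m → ℝ) :
    (allPrices r p' - allPrices r p) ⬝ᵥ q = (p' - p) ⬝ᵥ fun i => q (Sum.inl i) := by
  simp [allPrices, dotProduct, Fintype.sum_sum_type]

theorem integral_add_mul_add_mul {f g h : Ω → ℝ} (hf : Integrable f F)
    (hg : Integrable g F) (hh : Integrable h F) (c d : ℝ) :
    ∫ ω, (f ω + c * (g ω + d * h ω)) ∂F =
      ∫ ω, f ω ∂F + c * (∫ ω, g ω ∂F + d * ∫ ω, h ω ∂F) := by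
  have h1 : Integrable (fun ω => g ω + d * h ω) F := hg.add (hh.const_mul d)
  rw [integral_add hf (h1.const_mul c), integral_const_mul, integral_add hg (hh.const_mul d),
    integral_const_mul]

namespace RegularPopulation

theorem continuousOn_utility (hreg : RegularPopulation F Q u r P Y) (ω : Ω) :
    ContinuousOn (u ω) Q := (hreg.utility_smooth ω).continuousOn

theorem nonsatiatedAt (hreg : RegularPopulation F Q u r P Y) (ω : Ω) {p : Fin k → ℝ} (hp : p ∈ P)
    {y : ℝ} (hy : y ∈ Y) : Nonsatiated Q (u ω) (allPrices r p) y :=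
  hreg.nonsatiated ω p hp y hy

theorem demand_mem (hreg : RegularPopulation F Q u r P Y) (ω : Ω) {p : Fin k → ℝ} (hp : p ∈ P)
    {y : ℝ} (hy : y ∈ Y) : demand Q (u ω) (allPrices r p) y ∈ Q :=
  (demand_spec hreg.bundles_compact (hreg.continuousOn_utility ω)
    (hreg.affordable p hp y hy)).1.1

theorem indirectUtility_attained (hreg : RegularPopulation F Q u r P Y) (ω : Ω) {p : Fin k → ℝ}
    (hp : p ∈ P) {y : ℝ} (hy : y ∈ Y) :
    ∃ q ∈ Q, indirectUtility Q (u ω) (allPrices r p) y ≤ u ω q :=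
  ⟨_, hreg.demand_mem ω hp hy, (indirectUtility_eq hreg.bundles_compact
    (hreg.continuousOn_utility ω) (hreg.affordable p hp y hy)).le⟩

theorem expenditure_indirectUtility (hreg : RegularPopulation F Q u r P Y) (ω : Ω)
    {p : Fin k → ℝ} (hp : p ∈ P) {y : ℝ} (hy : y ∈ Y) :
    expenditure Q (u ω) (allPrices r p) (indirectUtility Q (u ω) (allPrices r p) y) = y :=
  (hreg.nonsatiatedAt ω hp hy).expenditure_indirectUtility hreg.bundles_compact
    (hreg.continuousOn_utility ω) (hreg.affordable p hp y hy)

theorem compensatingVariation_eq (hreg : RegularPopulation F Q u r P Y) (ω : Ω)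
    (p₀ : Fin k → ℝ) {p₁ : Fin k → ℝ} (hp₁ : p₁ ∈ P) {y : ℝ} (hy : y ∈ Y) :
    compensatingVariation Q (u ω) (allPrices r p₀) (allPrices r p₁) y =
      expenditure Q (u ω) (allPrices r p₁) (indirectUtility Q (u ω) (allPrices r p₀) y) - y := by
  rw [compensatingVariation, hreg.expenditure_indirectUtility ω hp₁ hy]

theorem exists_bound (hreg : RegularPopulation F Q u r P Y) :
    ∃ C, 0 ≤ C ∧ ∀ q ∈ Q, ‖fun i => q (Sum.inl i)‖ ≤ C := by
  obtain ⟨C, hC0, hC⟩ := hreg.bundles_compact.isBounded.exists_pos_norm_le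
  exact ⟨C, hC0.le, fun q hq => (pi_norm_le_iff_of_nonneg hC0.le).2 fun i =>
    (norm_le_pi_norm q (Sum.inl i)).trans (hC q hq)⟩

theorem measurable_demandK (hreg : RegularPopulation F Q u r P Y) {p : Fin k → ℝ} (hp : p ∈ P)
    {y : ℝ} (hy : y ∈ Y) : Measurable fun ω => demandK Q (u ω) r p y :=
  measurable_pi_lambda _ fun i => (measurable_pi_apply (Sum.inl i)).comp
    (measurable_demand hreg.bundles_compact hreg.bundles_convex hreg.continuousOn_utility
      hreg.utility_strictQuasiconcave hreg.utility_measurable (hreg.affordable p hp y hy))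

theorem abs_expenditure_sub_le (hreg : RegularPopulation F Q u r P Y) (ω : Ω) {C : ℝ}
    (hC : ∀ q ∈ Q, ‖fun i => q (Sum.inl i)‖ ≤ C) {c : ℝ} (hc : ∃ q ∈ Q, c ≤ u ω q)
    (p p' : Fin k → ℝ) :
    |expenditure Q (u ω) (allPrices r p') c - expenditure Q (u ω) (allPrices r p) c| ≤
      k * (‖p' - p‖ * C) := by
  refine CVMoments.abs_expenditure_sub_le hreg.bundles_compact (hreg.continuousOn_utility ω) hc
    _ _ fun q hq => ?_
  rw [allPrices_sub_dotProduct]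
  refine (abs_dotProduct_le _ _).trans ?_
  rw [Fintype.card_fin]
  gcongr
  exact hC q hq

theorem measurable_compensatingVariation (hreg : RegularPopulation F Q u r P Y)
    {p₀ p₁ : Fin k → ℝ} (hp₀ : p₀ ∈ P) (hp₁ : p₁ ∈ P) {y : ℝ} (hy : y ∈ Y) :
    Measurable fun ω => compensatingVariation Q (u ω) (allPrices r p₀) (allPrices r p₁) y := by
  simp only [hreg.compensatingVariation_eq _ p₀ hp₁ hy]
  exact (measurable_expenditure hreg.bundles_compact hreg.continuousOn_utility
    hreg.utility_measurable (measurable_indirectUtility hreg.bundles_compact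
      hreg.continuousOn_utility hreg.utility_measurable _ _)
    (fun ω => hreg.indirectUtility_attained ω hp₀ hy) _).sub_const y

/-- The Lipschitz bound on expenditure is uniform in the type, so the CV is a bounded function on a
finite measure space. -/
theorem integrable_compensatingVariation_pow [IsFiniteMeasure F]
    (hreg : RegularPopulation F Q u r P Y) (n : ℕ)
    {p₀ p₁ : Fin k → ℝ} (hp₀ : p₀ ∈ P) (hp₁ : p₁ ∈ P) {y : ℝ} (hy : y ∈ Y) :
    Integrable (fun ω => compensatingVariation Q (u ω) (allPrices r p₀) (allPrices r p₁) y ^ n)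
      F := by
  obtain ⟨C, -, hC⟩ := hreg.exists_bound
  refine Integrable.of_bound
    ((hreg.measurable_compensatingVariation hp₀ hp₁ hy).pow_const n).aestronglyMeasurable
    ((k * (‖p₁ - p₀‖ * C)) ^ n) (Filter.Eventually.of_forall fun ω => ?_)
  rw [norm_pow, hreg.compensatingVariation_eq ω p₀ hp₁ hy]
  refine pow_le_pow_left₀ (norm_nonneg _) ?_ n
  have := hreg.abs_expenditure_sub_le ω hC (hreg.indirectUtility_attained ω hp₀ hy) p₀ p₁
  rwa [hreg.expenditure_indirectUtility ω hp₀ hy] at this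

theorem integrable_tensorPower [IsFiniteMeasure F] (hreg : RegularPopulation F Q u r P Y)
    {p : Fin k → ℝ} (hp : p ∈ P) {y : ℝ} (hy : y ∈ Y) (n : ℕ) (i : Fin n → Fin k) :
    Integrable (fun ω => tensorPower n (demandK Q (u ω) r p y) i) F := by
  obtain ⟨C, -, hC⟩ := hreg.exists_bound
  refine Integrable.of_bound ((contDiff_tensorPower i).continuous.measurable.comp
    (hreg.measurable_demandK hp hy)).aestronglyMeasurable (C ^ n)
    (Filter.Eventually.of_forall fun ω => ?_)
  rw [tensorPower, norm_prod]
  refine (Finset.prod_le_prod (fun _ _ => norm_nonneg _) fun j _ => ?_).trans_eq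
    (Fin.prod_const n C)
  exact (norm_le_pi_norm (fun i => demand Q (u ω) (allPrices r p) y (Sum.inl i)) (i j)).trans
    (hC _ (hreg.demand_mem ω hp hy))

theorem tensorForm_moment [IsFiniteMeasure F] (hreg : RegularPopulation F Q u r P Y)
    {p : Fin k → ℝ} (hp : p ∈ P) {y : ℝ} (hy : y ∈ Y) (n : ℕ) (v : Fin k → ℝ) :
    tensorForm v (moment F Q u r n p y) = ∫ ω, (v ⬝ᵥ demandK Q (u ω) r p y) ^ n ∂F := by
  simp only [← tensorForm_tensorPower, tensorForm, moment]
  rw [integral_finsetSum _ fun i _ => (hreg.integrable_tensorPower hp hy n i).mul_const _]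
  simp only [integral_mul_const]

/-- Local bounds on the first two derivatives of demand: `√G` dominates the first derivative and `G`
the second one, where `G` is integrable. -/
theorem exists_local_bounds [IsFiniteMeasure F] (hreg : RegularPopulation F Q u r P Y)
    {p₀ : Fin k → ℝ} (hp₀ : p₀ ∈ P) {y : ℝ} (hy : y ∈ Y) :
    ∃ ρ C K : ℝ, ∃ G : Ω → ℝ, 0 < ρ ∧ 0 ≤ C ∧ 0 ≤ K ∧ Integrable G F ∧ (∀ ω, 1 ≤ G ω) ∧
      Metric.ball (p₀, y) ρ ⊆ P ×ˢ Y ∧ (∀ q ∈ Q, ‖fun i => q (Sum.inl i)‖ ≤ C) ∧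
      ∀ ω, ∀ z ∈ Metric.ball (p₀, y) ρ,
        DifferentiableAt ℝ (fun z : (Fin k → ℝ) × ℝ => demandK Q (u ω) r z.1 z.2) z ∧
        ‖fderiv ℝ (fun z : (Fin k → ℝ) × ℝ => demandK Q (u ω) r z.1 z.2) z‖ ≤ K * √(G ω) ∧
        ‖fderiv ℝ (fun z : (Fin k → ℝ) × ℝ => demandK Q (u ω) r z.1 z.2) z -
          fderiv ℝ (fun z : (Fin k → ℝ) × ℝ => demandK Q (u ω) r z.1 z.2) (p₀, y)‖ ≤
          G ω * ‖z - (p₀, y)‖ := by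
  have hU : IsOpen (P ×ˢ Y) := hreg.prices_open.prod hreg.incomes_open
  have hz₀ : (p₀, y) ∈ P ×ˢ Y := ⟨hp₀, hy⟩
  obtain ⟨R, hR, hRU⟩ := Metric.isOpen_iff.1 hU _ hz₀
  obtain ⟨C, hC0, hC⟩ := hreg.exists_bound
  obtain ⟨g, hg, hgb⟩ := hreg.demand_dominated 2
  -- Landau's inequality on the ball of radius ρ needs bounds on the doubled ball, and ρ ≤ 1.
  set ρ := min 1 (R / 2)
  have hρ : 0 < ρ := by positivity
  have hsub : Metric.ball (p₀, y) (2 * ρ) ⊆ P ×ˢ Y :=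
    (Metric.ball_subset_ball (by linarith [min_le_right 1 (R / 2)])).trans hRU
  have hsub' : Metric.ball (p₀, y) ρ ⊆ Metric.ball (p₀, y) (2 * ρ) :=
    Metric.ball_subset_ball (by linarith)
  have hg0 : ∀ ω, 0 ≤ g ω := fun ω => (norm_nonneg _).trans (hgb ω _ hz₀)
  refine ⟨ρ, C, 4 * C / ρ + 1, fun ω => 1 + g ω, hρ, hC0, by positivity,
    (integrable_const 1).add hg, fun ω => by linarith [hg0 ω], hsub'.trans hsub, hC,
    fun ω z hz => ?_⟩
  have hd : ∀ z ∈ Metric.ball (p₀, y) (2 * ρ),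
      DifferentiableAt ℝ (fun z : (Fin k → ℝ) × ℝ => demandK Q (u ω) r z.1 z.2) z := fun z hz =>
    ((hreg.demand_smooth ω).contDiffAt (hU.mem_nhds (hsub hz))).differentiableAt (by simp)
  have hLip := norm_fderiv_sub_le hU (hreg.demand_smooth ω) hsub (G := 1 + g ω)
    fun z hz => (hgb ω z hz).trans (by linarith)
  refine ⟨hd z (hsub' hz), ?_, hLip _ (hsub' (Metric.mem_ball_self hρ)) z (hsub' hz)⟩
  exact norm_fderiv_le_sqrt hρ (min_le_left _ _) (by linarith [hg0 ω]) hC0 hd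
    (fun z hz => hC _ (hreg.demand_mem ω (hsub hz).1 (hsub hz).2)) hLip z hz

/-- The second-order expansion of the individual compensating variation, with a remainder that is
uniformly dominated by an integrable function of the type. -/
theorem exists_compensatingVariation_expansion [IsFiniteMeasure F]
    (hreg : RegularPopulation F Q u r P Y) {p₀ : Fin k → ℝ} (hp₀ : p₀ ∈ P) {y : ℝ} (hy : y ∈ Y) :
    ∃ ρ D B : ℝ, ∃ G : Ω → ℝ, 0 < ρ ∧ 0 < D ∧ Integrable G F ∧
      ∀ Δ : Fin k → ℝ, D * ‖Δ‖ < ρ → p₀ + Δ ∈ P ∧ ∀ ω, ∀ x a b : ℝ,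
        x = compensatingVariation Q (u ω) (allPrices r p₀) (allPrices r (p₀ + Δ)) y →
        a = Δ ⬝ᵥ demandK Q (u ω) r p₀ y →
        b = 1 / 2 * (Δ ⬝ᵥ fderiv ℝ (fun z : (Fin k → ℝ) × ℝ => demandK Q (u ω) r z.1 z.2)
          (p₀, y) (Δ, a)) →
        |x| ≤ D * ‖Δ‖ ∧ |a| ≤ D * ‖Δ‖ ∧ (x - a) ^ 2 ≤ (D * ‖Δ‖) ^ 4 * (B * G ω) ∧
          |x - a - b| ≤ (D * ‖Δ‖) ^ 3 * (B * G ω) := by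
  obtain ⟨ρ, C, K, G, hρ, hC0, hK, hG, hG1, hball, hC, hloc⟩ := hreg.exists_local_bounds hp₀ hy
  -- The summands of D serve, in turn, the bounds on Δ ⬝ᵥ demand and on the slope of h, the bound on
  -- Δ ⬝ᵥ v for general v, and ‖Δ‖ ≤ M. The factor 1 + K ^ 2 collects G + (K √G) ^ 2.
  refine ⟨ρ, k * C + k + 1, 1 + K ^ 2, G, hρ, by positivity, hG, fun Δ hΔ => ?_⟩
  set M := (k * C + k + 1) * ‖Δ‖
  have hn := norm_nonneg Δ
  have hM0 : 0 ≤ M := by positivity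
  have hkC : k * (‖Δ‖ * C) ≤ M := by
    simp only [M]; nlinarith [mul_nonneg (Nat.cast_nonneg (α := ℝ) k) hn]
  have hk : k * ‖Δ‖ ≤ M := by
    simp only [M]; nlinarith [mul_nonneg (mul_nonneg (Nat.cast_nonneg (α := ℝ) k) hC0) hn]
  have hΔM : ‖Δ‖ ≤ M := le_mul_of_one_le_left hn
    (by linarith [mul_nonneg (Nat.cast_nonneg (α := ℝ) k) hC0, Nat.cast_nonneg (α := ℝ) k])
  have hmem : p₀ + Δ ∈ P := by
    refine (hball (a := (p₀ + Δ, y)) ?_).1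
    rw [mem_ball_iff_norm]
    simpa using hΔM.trans_lt hΔ
  refine ⟨hmem, ?_⟩
  rintro ω x a b hx ha rfl
  have hdot : ∀ v : Fin k → ℝ, |Δ ⬝ᵥ v| ≤ M * ‖v‖ := fun v => by
    refine (abs_dotProduct_le _ _).trans ?_
    rw [Fintype.card_fin, ← mul_assoc]
    exact mul_le_mul_of_nonneg_right hk (norm_nonneg _)
  have hZM : ∀ z ∈ Metric.ball (p₀, y) ρ, |Δ ⬝ᵥ demandK Q (u ω) r z.1 z.2| ≤ M := fun z hz => by
    refine (abs_dotProduct_le _ _).trans (le_trans ?_ hkC)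
    rw [Fintype.card_fin]
    gcongr
    exact hC _ (hreg.demand_mem ω (hball hz).1 (hball hz).2)
  have hatt := hreg.indirectUtility_attained ω hp₀ hy
  set c := indirectUtility Q (u ω) (allPrices r p₀) y with hc
  set h : ℝ → ℝ := fun t => expenditure Q (u ω) (allPrices r (p₀ + t • Δ)) c with hh
  have h0 : h 0 = y := by
    simp only [hh, zero_smul, add_zero, hc, hreg.expenditure_indirectUtility ω hp₀ hy]
  have hx1 : x = h 1 - y := by
    rw [hx, hreg.compensatingVariation_eq ω p₀ hmem hy]
    simp [hh, hc]
  have hLip : ∀ s t : ℝ, |h s - h t| ≤ M * |s - t| := fun s t => by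
    refine (hreg.abs_expenditure_sub_le ω hC hatt _ _).trans ?_
    rw [add_sub_add_left_eq_sub, ← sub_smul, norm_smul, Real.norm_eq_abs]
    nlinarith [abs_nonneg (s - t)]
  -- The tangent inequality needs nonsatiation at the compensated income h t, which is assumed only
  -- on P × Y; hence the restriction to the ball.
  have hle : ∀ s ∈ Set.Icc (0 : ℝ) 1, ∀ t ∈ Set.Icc (0 : ℝ) 1,
      (p₀ + t • Δ, h t) ∈ Metric.ball (p₀, y) ρ →
      h s ≤ h t + (s - t) * (Δ ⬝ᵥ demandK Q (u ω) r (p₀ + t • Δ) (h t)) := by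
    intro s _ t _ hz
    refine (Nonsatiated.expenditure_le_add hreg.bundles_compact (hreg.continuousOn_utility ω) hatt
      (hreg.nonsatiatedAt ω (hball hz).1 (hball hz).2) (allPrices r (p₀ + s • Δ))).trans_eq ?_
    rw [allPrices_sub_dotProduct, add_sub_add_left_eq_sub, ← sub_smul, smul_dotProduct, smul_eq_mul]
    rfl
  have hsqG : √(G ω) ^ 2 = G ω := Real.sq_sqrt (by linarith [hG1 ω])
  obtain ⟨e1, e2⟩ := path_expansion (Z := fun z => demandK Q (u ω) r z.1 z.2)
    (S := K * √(G ω)) (G := G ω) hM0 hΔM hΔ h0 (by positivity) (by linarith [hG1 ω])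
    (fun s _ t _ => hLip s t) hle hdot hZM (fun z hz => (hloc ω z hz).1)
    (fun z hz => (hloc ω z hz).2.1) (fun z hz => (hloc ω z hz).2.2)
  rw [← hx1] at e1 e2
  simp only [← ha] at e1 e2
  refine ⟨?_, ?_, ?_, ?_⟩
  · have := hLip 1 0
    rwa [h0, ← hx1, sub_zero, abs_one, mul_one] at this
  · rw [ha]
    exact hZM (p₀, y) (Metric.mem_ball_self hρ)
  · calc (x - a) ^ 2 = |x - a| ^ 2 := (sq_abs _).symm
      _ ≤ (M ^ 2 * (K * √(G ω))) ^ 2 := by gcongr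
      _ = M ^ 4 * (K ^ 2 * G ω) := by rw [mul_pow, mul_pow K, hsqG]; ring
      _ ≤ M ^ 4 * ((1 + K ^ 2) * G ω) := by
        have := hG1 ω
        gcongr
        linarith
  · refine e2.trans_eq ?_
    rw [mul_pow K, hsqG]
    ring

/-- Moments of demand are differentiable, under the integral sign. -/
theorem hasFDerivAt_integral_demandK [IsFiniteMeasure F] (hreg : RegularPopulation F Q u r P Y)
    {p₀ : Fin k → ℝ} (hp₀ : p₀ ∈ P) {y : ℝ} (hy : y ∈ Y) {Φ : (Fin k → ℝ) → ℝ}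
    (hΦ : ContDiff ℝ 1 Φ) :
    Integrable (fun ω => Φ (demandK Q (u ω) r p₀ y)) F ∧
    Integrable (fun ω => fderiv ℝ
      (fun z : (Fin k → ℝ) × ℝ => Φ (demandK Q (u ω) r z.1 z.2)) (p₀, y)) F ∧
    HasFDerivAt (fun z : (Fin k → ℝ) × ℝ => ∫ ω, Φ (demandK Q (u ω) r z.1 z.2) ∂F)
      (∫ ω, fderiv ℝ (fun z : (Fin k → ℝ) × ℝ => Φ (demandK Q (u ω) r z.1 z.2)) (p₀, y) ∂F)
      (p₀, y) := by
  obtain ⟨ρ, C, K, G, hρ, hC0, hK, hG, hG1, hball, hC, hloc⟩ := hreg.exists_local_bounds hp₀ hy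
  refine hasFDerivAt_integral_comp (X := (Fin k → ℝ) × ℝ) (V := Fin k → ℝ) (F := F)
    (Z := fun ω z => demandK Q (u ω) r z.1 z.2) (g := fun ω => K * G ω) hρ
    (fun z hz => hreg.measurable_demandK (hball hz).1 (hball hz).2)
    (fun ω z hz => hC _ (hreg.demand_mem ω (hball hz).1 (hball hz).2))
    (fun ω z hz => (hloc ω z hz).1) (hG.const_mul K) (fun ω z hz => (hloc ω z hz).2.1.trans ?_) hΦ
  have := hG1 ω
  -- √G ≤ G because 1 ≤ G, so G also dominates the first derivative.
  exact mul_le_mul_of_nonneg_left (Real.sqrt_le_iff.2 ⟨by linarith, by nlinarith⟩) hK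

theorem hasFDerivAt_moment_price [IsFiniteMeasure F] (hreg : RegularPopulation F Q u r P Y)
    {p₀ : Fin k → ℝ} (hp₀ : p₀ ∈ P) {y : ℝ} (hy : y ∈ Y) {Φ : (Fin k → ℝ) → ℝ}
    (hΦ : ContDiff ℝ 1 Φ) :
    HasFDerivAt (fun p => ∫ ω, Φ (demandK Q (u ω) r p y) ∂F)
      ((∫ ω, fderiv ℝ (fun z : (Fin k → ℝ) × ℝ => Φ (demandK Q (u ω) r z.1 z.2)) (p₀, y) ∂F).comp
        (ContinuousLinearMap.inl ℝ (Fin k → ℝ) ℝ)) p₀ :=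
  HasFDerivAt.comp (g := fun z : (Fin k → ℝ) × ℝ => ∫ ω, Φ (demandK Q (u ω) r z.1 z.2) ∂F)
    (f := fun p => (p, y)) p₀ (hreg.hasFDerivAt_integral_demandK hp₀ hy hΦ).2.2
    (hasFDerivAt_prodMk_left p₀ y)

theorem hasDerivAt_moment_income [IsFiniteMeasure F] (hreg : RegularPopulation F Q u r P Y)
    {p₀ : Fin k → ℝ} (hp₀ : p₀ ∈ P) {y : ℝ} (hy : y ∈ Y) {Φ : (Fin k → ℝ) → ℝ}
    (hΦ : ContDiff ℝ 1 Φ) :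
    HasDerivAt (fun y => ∫ ω, Φ (demandK Q (u ω) r p₀ y) ∂F)
      ((∫ ω, fderiv ℝ (fun z : (Fin k → ℝ) × ℝ => Φ (demandK Q (u ω) r z.1 z.2)) (p₀, y) ∂F)
        (0, 1)) y :=
  (hreg.hasFDerivAt_integral_demandK hp₀ hy hΦ).2.2.comp_hasDerivAt y
    ((hasDerivAt_const y p₀).prodMk (hasDerivAt_id y))

theorem fderiv_dotProduct_pow [IsFiniteMeasure F] (hreg : RegularPopulation F Q u r P Y) (ω : Ω)
    {p₀ : Fin k → ℝ} (hp₀ : p₀ ∈ P) {y : ℝ} (hy : y ∈ Y) (n : ℕ) (v : Fin k → ℝ)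
    (w : (Fin k → ℝ) × ℝ) :
    fderiv ℝ (fun z : (Fin k → ℝ) × ℝ => (v ⬝ᵥ demandK Q (u ω) r z.1 z.2) ^ (n + 1)) (p₀, y) w =
      (n + 1) * (v ⬝ᵥ demandK Q (u ω) r p₀ y) ^ n *
        (v ⬝ᵥ fderiv ℝ (fun z : (Fin k → ℝ) × ℝ => demandK Q (u ω) r z.1 z.2) (p₀, y) w) := by
  obtain ⟨ρ, C, K, G, hρ, -, -, -, -, -, -, hloc⟩ := hreg.exists_local_bounds hp₀ hy
  have hd := hasFDerivAt_pi'.1 (hloc ω _ (Metric.mem_ball_self hρ)).1.hasFDerivAt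
  have h1 : HasFDerivAt (fun z : (Fin k → ℝ) × ℝ => v ⬝ᵥ demandK Q (u ω) r z.1 z.2) _ (p₀, y) :=
    HasFDerivAt.fun_sum fun i _ => (hd i).const_mul (v i)
  rw [(h1.pow (n + 1)).fderiv]
  simp [dotProduct]

/-- The second-order approximation is the expectation of the individual one. -/
theorem secondOrderCV_eq_integral [IsFiniteMeasure F] (hreg : RegularPopulation F Q u r P Y)
    {p₀ : Fin k → ℝ} (hp₀ : p₀ ∈ P) {y : ℝ} (hy : y ∈ Y) (n : ℕ) (Δ : Fin k → ℝ) :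
    Integrable (fun ω => (Δ ⬝ᵥ demandK Q (u ω) r p₀ y) ^ (n + 1) +
        (n + 1) * (Δ ⬝ᵥ demandK Q (u ω) r p₀ y) ^ n * (1 / 2 * (Δ ⬝ᵥ fderiv ℝ
          (fun z : (Fin k → ℝ) × ℝ => demandK Q (u ω) r z.1 z.2) (p₀, y)
            (Δ, Δ ⬝ᵥ demandK Q (u ω) r p₀ y)))) F ∧
    secondOrderCV (n + 1) (moment F Q u r (n + 1)) (moment F Q u r (n + 1 + 1)) p₀ y Δ =
      ∫ ω, ((Δ ⬝ᵥ demandK Q (u ω) r p₀ y) ^ (n + 1) +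
        (n + 1) * (Δ ⬝ᵥ demandK Q (u ω) r p₀ y) ^ n * (1 / 2 * (Δ ⬝ᵥ fderiv ℝ
          (fun z : (Fin k → ℝ) × ℝ => demandK Q (u ω) r z.1 z.2) (p₀, y)
            (Δ, Δ ⬝ᵥ demandK Q (u ω) r p₀ y)))) ∂F := by
  have hΦ : ∀ l : ℕ, ContDiff ℝ 1 fun q : Fin k → ℝ => (Δ ⬝ᵥ q) ^ l := fun l =>
    (ContDiff.sum fun i _ => contDiff_const.mul (contDiff_apply ℝ ℝ i)).pow l
  obtain ⟨i1, j1, -⟩ := hreg.hasFDerivAt_integral_demandK hp₀ hy (hΦ (n + 1))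
  obtain ⟨-, j2, -⟩ := hreg.hasFDerivAt_integral_demandK hp₀ hy (hΦ (n + 1 + 1))
  have i2 := j1.apply_continuousLinearMap (Δ, 0)
  have i3 := j2.apply_continuousLinearMap (0, 1)
  have hp : fderiv ℝ (fun p => tensorForm Δ (moment F Q u r (n + 1) p y)) p₀ Δ =
      ∫ ω, fderiv ℝ (fun z : (Fin k → ℝ) × ℝ => (Δ ⬝ᵥ demandK Q (u ω) r z.1 z.2) ^ (n + 1))
        (p₀, y) (Δ, 0) ∂F := by
    have he : (fun p => tensorForm Δ (moment F Q u r (n + 1) p y)) =ᶠ[𝓝 p₀]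
        fun p => ∫ ω, (Δ ⬝ᵥ demandK Q (u ω) r p y) ^ (n + 1) ∂F := by
      filter_upwards [hreg.prices_open.mem_nhds hp₀] with p hp
      exact hreg.tensorForm_moment hp hy _ _
    rw [he.fderiv_eq, (hreg.hasFDerivAt_moment_price hp₀ hy (hΦ (n + 1))).fderiv]
    exact ContinuousLinearMap.integral_apply j1 _
  have hy' : deriv (fun y => tensorForm Δ (moment F Q u r (n + 1 + 1) p₀ y)) y =
      ∫ ω, fderiv ℝ (fun z : (Fin k → ℝ) × ℝ => (Δ ⬝ᵥ demandK Q (u ω) r z.1 z.2) ^ (n + 1 + 1))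
        (p₀, y) (0, 1) ∂F := by
    have he : (fun y => tensorForm Δ (moment F Q u r (n + 1 + 1) p₀ y)) =ᶠ[𝓝 y]
        fun y => ∫ ω, (Δ ⬝ᵥ demandK Q (u ω) r p₀ y) ^ (n + 1 + 1) ∂F := by
      filter_upwards [hreg.incomes_open.mem_nhds hy] with y hy
      exact hreg.tensorForm_moment hp₀ hy _ _
    rw [he.deriv_eq, (hreg.hasDerivAt_moment_income hp₀ hy (hΦ (n + 1 + 1))).deriv]
    exact ContinuousLinearMap.integral_apply j2 _
  have hpt : ∀ ω, (Δ ⬝ᵥ demandK Q (u ω) r p₀ y) ^ (n + 1) +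
        (n + 1) * (Δ ⬝ᵥ demandK Q (u ω) r p₀ y) ^ n * (1 / 2 * (Δ ⬝ᵥ fderiv ℝ
          (fun z : (Fin k → ℝ) × ℝ => demandK Q (u ω) r z.1 z.2) (p₀, y)
            (Δ, Δ ⬝ᵥ demandK Q (u ω) r p₀ y))) =
      (Δ ⬝ᵥ demandK Q (u ω) r p₀ y) ^ (n + 1) + 1 / 2 *
        (fderiv ℝ (fun z : (Fin k → ℝ) × ℝ => (Δ ⬝ᵥ demandK Q (u ω) r z.1 z.2) ^ (n + 1))
          (p₀, y) (Δ, 0) + ((n + 1 : ℕ) : ℝ) / (((n + 1 : ℕ) : ℝ) + 1) *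
        fderiv ℝ (fun z : (Fin k → ℝ) × ℝ => (Δ ⬝ᵥ demandK Q (u ω) r z.1 z.2) ^ (n + 1 + 1))
          (p₀, y) (0, 1)) := by
    intro ω
    rw [hreg.fderiv_dotProduct_pow ω hp₀ hy, hreg.fderiv_dotProduct_pow ω hp₀ hy]
    set a := Δ ⬝ᵥ demandK Q (u ω) r p₀ y
    -- The income direction carries an extra factor a, which raises a ^ n to a ^ (n + 1): the
    -- derivative of the next power, up to the ratio of the exponents.
    have e : ((Δ, a) : (Fin k → ℝ) × ℝ) = (Δ, 0) + a • (0, 1) := by simp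
    rw [e, map_add, map_smul, dotProduct_add, dotProduct_smul, smul_eq_mul]
    push_cast
    field_simp
    ring
  simp only [hpt]
  refine ⟨i1.add ((i2.add (i3.const_mul _)).const_mul _), ?_⟩
  rw [integral_add_mul_add_mul i1 i2 i3, secondOrderCV, tensorForm_add, tensorForm_smul, tensorForm_symmetrize, hreg.tensorForm_moment hp₀ hy, tensorForm_priceDeriv,
    tensorForm_incomeDeriv, hp, hy']
  · exact fun i =>
      (hreg.hasDerivAt_moment_income hp₀ hy (contDiff_tensorPower i)).differentiableAt
  · exact fun i =>
      (hreg.hasFDerivAt_moment_price hp₀ hy (contDiff_tensorPower i)).differentiableAt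

/-- The remainder for each type is a power of ‖Δ‖ times an integrable function of the type, so
taking expectations preserves the order. -/
theorem isBigO_moment_compensatingVariation [IsFiniteMeasure F]
    (hreg : RegularPopulation F Q u r P Y)
    {p₀ : Fin k → ℝ} (hp₀ : p₀ ∈ P) {y : ℝ} (hy : y ∈ Y) (n : ℕ) :
    (fun Δ : Fin k → ℝ =>
        (∫ ω, compensatingVariation Q (u ω) (allPrices r p₀) (allPrices r (p₀ + Δ)) y ^ (n + 1) ∂F)
        - secondOrderCV (n + 1) (moment F Q u r (n + 1)) (moment F Q u r (n + 1 + 1)) p₀ y Δ)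
      =O[𝓝 0] fun Δ => ‖Δ‖ ^ (n + 1 + 2) := by
  obtain ⟨ρ, D, B, G, hρ, hD, hG, hexp⟩ := hreg.exists_compensatingVariation_expansion hp₀ hy
  refine Asymptotics.IsBigO.of_bound
    (((n + 1) ^ 2 + (n + 1)) * (D ^ (n + 3) * (B * ∫ ω, G ω ∂F))) ?_
  have hev : ∀ᶠ Δ : Fin k → ℝ in 𝓝 0, D * ‖Δ‖ < ρ := by
    have hcont : Continuous fun Δ : Fin k → ℝ => D * ‖Δ‖ := by fun_prop
    exact (isOpen_lt hcont continuous_const).mem_nhds (by simpa using hρ)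
  filter_upwards [hev] with Δ hΔ
  obtain ⟨hmem, hω⟩ := hexp Δ hΔ
  obtain ⟨hint, hsec⟩ := hreg.secondOrderCV_eq_integral hp₀ hy n Δ
  rw [hsec, ← integral_sub (hreg.integrable_compensatingVariation_pow _ hp₀ hmem hy) hint]
  refine (norm_integral_le_of_norm_le
    (((hG.const_mul B).const_mul ((D * ‖Δ‖) ^ (n + 3))).const_mul (((n : ℝ) + 1) ^ 2 + (n + 1)))
    (Filter.Eventually.of_forall fun ω => ?_)).trans_eq ?_
  · obtain ⟨h1, h2, h3, h4⟩ := hω ω _ _ _ rfl rfl rfl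
    exact abs_pow_sub_expansion_le h1 h2 h3 h4 n
  · rw [integral_const_mul, integral_const_mul, integral_const_mul, norm_pow, norm_norm]
    ring

end RegularPopulation

end Population

end CVMoments

theorem mainTheorem10 {k m : ℕ} {Ω : Type*} [MeasurableSpace Ω] (F : MeasureTheory.Measure Ω)
    [MeasureTheory.IsProbabilityMeasure F]
    (Q : Set (Fin k ⊕ Fin m → ℝ)) (u : Ω → (Fin k ⊕ Fin m → ℝ) → ℝ)
    (r : Fin m → ℝ) (P : Set (Fin k → ℝ)) (Y : Set ℝ)
    (hreg : CVMoments.RegularPopulation F Q u r P Y)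
    (n : ℕ) (hn : 1 ≤ n) (p₀ : Fin k → ℝ) (hp₀ : p₀ ∈ P) (y : ℝ) (hy : y ∈ Y) :
    -- the moments of the CV and of demand exist
    (∀ p₁ ∈ P, MeasureTheory.Integrable (fun ω => CVMoments.compensatingVariation Q (u ω)
        (CVMoments.allPrices r p₀) (CVMoments.allPrices r p₁) y ^ n) F) ∧
    (∀ p ∈ P, ∀ y' ∈ Y, ∀ l : ℕ, ∀ i : Fin l → Fin k, MeasureTheory.Integrable
        (fun ω => CVMoments.tensorPower l (CVMoments.demandK Q (u ω) r p y') i) F) ∧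
    -- the derivatives of the moments of demand exist
    (∀ i, DifferentiableAt ℝ (fun p => CVMoments.moment F Q u r n p y i) p₀) ∧
    (∀ i, DifferentiableAt ℝ (fun y' => CVMoments.moment F Q u r (n + 1) p₀ y' i) y) ∧
    -- the second-order approximation
    ((fun Δ : Fin k → ℝ =>
        (∫ ω, CVMoments.compensatingVariation Q (u ω)
          (CVMoments.allPrices r p₀) (CVMoments.allPrices r (p₀ + Δ)) y ^ n ∂F)
        - CVMoments.secondOrderCV n (CVMoments.moment F Q u r n) (CVMoments.moment F Q u r (n + 1))
            p₀ y Δ)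
      =O[𝓝 0] fun Δ => ‖Δ‖ ^ (n + 2)) ∧
    -- the symmetrization may be replaced by the mean over the `n` nontrivial cyclic shifts
    (∀ Δ : Fin k → ℝ,
      CVMoments.tensorForm Δ
          (CVMoments.symmetrize (CVMoments.priceDeriv (CVMoments.moment F Q u r n) p₀ y)) =
        CVMoments.tensorForm Δ ((1 / (n : ℝ)) • ∑ s ∈ Finset.Icc 1 n,
          CVMoments.cyclicTranspose s
            (CVMoments.priceDeriv (CVMoments.moment F Q u r n) p₀ y))) := by
  -- Writing the order as a successor keeps the exponent n - 1 out of the expansion.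
  obtain ⟨n, rfl⟩ : ∃ l, n = l + 1 := ⟨n - 1, by omega⟩
  refine ⟨fun p₁ hp₁ => hreg.integrable_compensatingVariation_pow _ hp₀ hp₁ hy,
    fun p hp y' hy' l i => hreg.integrable_tensorPower hp hy' l i,
    fun i => (hreg.hasFDerivAt_moment_price hp₀ hy
      (CVMoments.contDiff_tensorPower i)).differentiableAt,
    fun i => (hreg.hasDerivAt_moment_income hp₀ hy
      (CVMoments.contDiff_tensorPower i)).differentiableAt,
    hreg.isBigO_moment_compensatingVariation hp₀ hy n, fun Δ => ?_⟩
  rw [CVMoments.tensorForm_symmetrize, CVMoments.tensorForm_mean_cyclicTranspose hn]
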